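/- Let $\zeta=e^{2\pi i/5}$. Let $$\mathbb B_2^A=\Big\{\eta=[\eta_1:\eta_2:\eta_3]\in\mathbb P^2(\mathbb C)\ :\ |\eta_1|^2+|\eta_2|^2+\tfrac{1-\sqrt5}{2}|\eta_3|^2<0\Big\}.$$ For $\eta\in\mathbb B_2^A$ put $\Delta=\eta_1^2+\eta_2^2-\zeta^3(1+\zeta)\eta_3^2$ and let $\Omega(\eta)=(\Omega_{ij})$ be the symmetric $6\times 6$ matrix with $$\begin{aligned} \Delta\Omega_{11}&=(\zeta^3-1)(\eta_1^2+(1+\zeta^3)\eta_2^2+\eta_3^2),& \Delta\Omega_{44}&=-\zeta^2(\eta_1^2+\zeta^2\eta_2^2-(1+\zeta)\eta_3^2),\\ \Delta\Omega_{22}&=(\zeta^3-1)((1+\zeta^3)\eta_1^2+\eta_2^2+\eta_3^2),& \Delta\Omega_{55}&=-\zeta^2(\zeta^2\eta_1^2+\eta_2^2-(1+\zeta)\eta_3^2),\\ \Delta\Omega_{33}&=(\zeta^2-1)(\eta_1^2+\eta_2^2-\zeta^3\eta_3^2),& \Delta\Omega_{66}&=-\zeta^3(\eta_1^2+\eta_2^2-(1+\zeta^4)\eta_3^2),\\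 \Delta\Omega_{12}&=(\zeta^3-\zeta)\eta_1\eta_2,& \Delta\Omega_{45}&=(\zeta^4-\zeta^2)\eta_1\eta_2,\\ \Delta\Omega_{15}&=\Delta\Omega_{24}=(\zeta^4-\zeta)\eta_1\eta_2,& &\\ \Delta\Omega_{13}&=(1-\zeta^2)\eta_1\eta_3,& \Delta\Omega_{23}&=(1-\zeta^2)\eta_2\eta_3,\\ \Delta\Omega_{46}&=(\zeta^4-\zeta)\eta_1\eta_3,& \Delta\Omega_{56}&=(\zeta^4-\zeta)\eta_2\eta_3,\\ \Delta\Omega_{16}&=(\zeta^3-\zeta)\eta_1\eta_3,& \Delta\Omega_{26}&=(\zeta^3-\zeta)\eta_2\eta_3,\\ \Delta\Omega_{34}&=(1-\zeta^3)\eta_1\eta_3,& \Delta\Omega_{35}&=(1-\zeta^3)\eta_2\eta_3,\\ \Delta\Omega_{14}&=\zeta^3((1+\zeta)\eta_1^2+(1+\zeta^3)\eta_2^2+\eta_3^2),& \Delta\Omega_{25}&=\zeta^3((1+\zeta^3)\eta_1^2+(1+\zeta)\eta_2^2+\eta_3^2),\\ \Delta\Omega_{36}&=(\zeta+\zeta^2)(\eta_1^2+\eta_2^2-\zeta^3(1+\zeta^2)\eta_3^2).&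 & \end{aligned}$$ (This is the normalized period matrix of the curves $y^5=\prod_{i=1}^5(x-\lambda_i)$ in terms of three periods.) For $a,b\in\mathbb R^6$ the theta constant is $$\Theta_{(a,b)}(\Omega)=\sum_{n\in\mathbb Z^6}\exp\big[\pi i\,{}^t(n+a)\Omega(n+a)+2\pi i\,{}^t(n+a)b\big].$$ For integers $a_1,a_2,a_3$ let $(a_1,a_2,a_3)$ also denote the characteristic $$a=\tfrac1{10}\,{}^t(a_1,a_2,a_3,a_1,a_2,a_3),\qquad b=\tfrac1{10}\,{}^t(-2a_1,-2a_2,-2a_3,-a_1,-a_2,-a_3).$$ A matrix $M=\begin{pmatrix}A&B\\C&D\end{pmatrix}\in\mathrm{Sp}_{12}(\mathbb Z)$ acts on characteristics by $M(a,b)=(Da-Cb,\,-Ba+Ab)+\tfrac12((C\,{}^tD)_0,(A\,{}^tB)_0)$, where $(X)_0$ is the vector of diagonal entries of $X$. Let $$\sigma=\left(\begin{array}{cccccc|cccccc} -1&0&0&0&0&0&-1&0&0&0&0&0\\ 0&-1&0&0&0&0&0&-1&0&0&0&0\\ 0&0&0&0&0&-1&0&0&-1&0&0&-1\\ -1&0&0&0&0&0&-1&0&0&-1&0&0\\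 0&-1&0&0&0&0&0&-1&0&0&-1&0\\ 0&0&1&0&0&-1&0&0&0&0&0&0\\ \hline 1&0&0&-1&0&0&0&0&0&0&0&0\\ 0&1&0&0&-1&0&0&0&0&0&0&0\\ 0&0&0&0&0&1&0&0&0&0&0&0\\ 0&0&0&1&0&0&0&0&0&0&0&0\\ 0&0&0&0&1&0&0&0&0&0&0&0\\ 0&0&0&0&0&0&0&0&1&0&0&0 \end{array}\right).$$ The characteristic $(a_1,a_2,a_3)$ is called $\sigma$-invariant if $\sigma(a,b)\equiv(a,b)$ modulo $\mathbb Z^{12}$; equivalently, $a_1,a_2,a_3$ are all odd. Put $\vartheta(a_1,a_2,a_3)=\{\eta\in\mathbb B_2^A:\Theta_{(a_1,a_2,a_3)}(\Omega(\eta))=0\}$. **Lemma.** 1. Let $(a_1,a_2,a_3)$ be $\sigma$-invariant with $2a_1^2+2a_2^2+a_3^2\notin5\mathbb Z$. Then for every $\eta\in\mathbb B_2^A$ the series defining $\Theta_{(a_1,a_2,a_3)}(\Omega(\eta))$ converges absolutely, and $\vartheta(a_1,a_2,a_3)=\mathbb B_2^A$; that is, $\Theta_{(a_1,a_2,a_3)}(\Omega(\eta))$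 vanishes identically on $\mathbb B_2^A$. 2. An integer triple $(a_1,a_2,a_3)$ is $\sigma$-invariant with $2a_1^2+2a_2^2+a_3^2\in5\mathbb Z$ if and only if it is congruent modulo $10$ to one (and then exactly one) of the 25 triples $$\begin{gathered}(1,1,1),(1,1,9),(1,9,1),(9,1,1),(1,3,5),(1,7,5),(3,1,5),(7,1,5),(3,3,3),(3,3,7),(3,7,3),(7,3,3),\\ (9,9,9),(9,9,1),(9,1,9),(1,9,9),(9,7,5),(9,3,5),(7,9,5),(3,9,5),(7,7,7),(7,7,3),(7,3,7),(3,7,7),\ (5,5,5).\end{gathered}$$ Hence $\vartheta(a_1,a_2,a_3)=\mathbb B_2^A$ for every $\sigma$-invariant $(a_1,a_2,a_3)$ that is not congruent modulo $10$ to one of these 25 triples. -/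

import Mathlib

open scoped Matrix LinearAlgebra.Projectivization

namespace PentagonalTheta

noncomputable section

/-! ### Riemann theta functions with real characteristics -/

/-- The term of index `n ∈ ℤ^g` of the series `Θ_{(a,b)}(z, Ω)`, that is
`exp (π i ᵗ(n + a) Ω (n + a) + 2 π i ᵗ(n + a) (z + b))`. -/
def thetaTerm {g : ℕ} (a b : Fin g → ℝ) (z : Fin g → ℂ) (Ω : Matrix (Fin g) (Fin g) ℂ)
    (n : Fin g → ℤ) : ℂ :=
  Complex.exp
    (Real.pi * Complex.I *
        ((fun i => (n i : ℂ) + (a i : ℂ)) ⬝ᵥ (Ω *ᵥ fun i => (n i : ℂ) + (a i : ℂ))) +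
      2 * Real.pi * Complex.I *
        ((fun i => (n i : ℂ) + (a i : ℂ)) ⬝ᵥ fun i => z i + (b i : ℂ)))

/-- The theta function `Θ_{(a,b)}(z, Ω)`. -/
def theta {g : ℕ} (a b : Fin g → ℝ) (z : Fin g → ℂ) (Ω : Matrix (Fin g) (Fin g) ℂ) : ℂ :=
  ∑' n : Fin g → ℤ, thetaTerm a b z Ω n

/-- The theta constant `Θ_{(a,b)}(Ω) = Θ_{(a,b)}(0, Ω)`. -/
def thetaConst {g : ℕ} (a b : Fin g → ℝ) (Ω : Matrix (Fin g) (Fin g) ℂ) : ℂ :=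
  theta a b 0 Ω

/-! ### The action of symplectic matrices on characteristics -/

/-- For `M = (A B; C D)`, the first component `Da - Cb + ½ (C ᵗD)₀` of `M (a, b)`. -/
def actFst {g : ℕ} (M : Matrix (Fin g ⊕ Fin g) (Fin g ⊕ Fin g) ℤ) (a b : Fin g → ℝ) :
    Fin g → ℝ := fun i =>
  (M.toBlocks₂₂.map (Int.cast : ℤ → ℝ) *ᵥ a) i - (M.toBlocks₂₁.map (Int.cast : ℤ → ℝ) *ᵥ b) i
    + (1 / 2 : ℝ) * ((M.toBlocks₂₁ * M.toBlocks₂₂ᵀ) i i : ℝ)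

/-- For `M = (A B; C D)`, the second component `-Ba + Ab + ½ (A ᵗB)₀` of `M (a, b)`. -/
def actSnd {g : ℕ} (M : Matrix (Fin g ⊕ Fin g) (Fin g ⊕ Fin g) ℤ) (a b : Fin g → ℝ) :
    Fin g → ℝ := fun i =>
  -(M.toBlocks₁₂.map (Int.cast : ℤ → ℝ) *ᵥ a) i + (M.toBlocks₁₁.map (Int.cast : ℤ → ℝ) *ᵥ b) i
    + (1 / 2 : ℝ) * ((M.toBlocks₁₁ * M.toBlocks₁₂ᵀ) i i : ℝ)

/-- The symplectic matrix `σ` of degree 12 induced by the automorphism `(x, y) ↦ (x, ζ y)`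
of the curves `y ^ 5 = ∏ (x - λ_i)`. -/
def sigma : Matrix (Fin 6 ⊕ Fin 6) (Fin 6 ⊕ Fin 6) ℤ :=
  Matrix.fromBlocks
    !![-1, 0, 0, 0, 0, 0;
       0, -1, 0, 0, 0, 0;
       0, 0, 0, 0, 0, -1;
       -1, 0, 0, 0, 0, 0;
       0, -1, 0, 0, 0, 0;
       0, 0, 1, 0, 0, -1]
    !![-1, 0, 0, 0, 0, 0;
       0, -1, 0, 0, 0, 0;
       0, 0, -1, 0, 0, -1;
       -1, 0, 0, -1, 0, 0;
       0, -1, 0, 0, -1, 0;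
       0, 0, 0, 0, 0, 0]
    !![1, 0, 0, -1, 0, 0;
       0, 1, 0, 0, -1, 0;
       0, 0, 0, 0, 0, 1;
       0, 0, 0, 1, 0, 0;
       0, 0, 0, 0, 1, 0;
       0, 0, 0, 0, 0, 0]
    !![0, 0, 0, 0, 0, 0;
       0, 0, 0, 0, 0, 0;
       0, 0, 0, 0, 0, 0;
       0, 0, 0, 0, 0, 0;
       0, 0, 0, 0, 0, 0;
       0, 0, 1, 0, 0, 0]

/-- The vector `a = (1/10) ᵗ(a₁, a₂, a₃, a₁, a₂, a₃)`. -/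
def charA (a : Fin 3 → ℤ) : Fin 6 → ℝ :=
  ![a 0 / 10, a 1 / 10, a 2 / 10, a 0 / 10, a 1 / 10, a 2 / 10]

/-- The vector `b = (1/10) ᵗ(-2a₁, -2a₂, -2a₃, -a₁, -a₂, -a₃)`. -/
def charB (a : Fin 3 → ℤ) : Fin 6 → ℝ :=
  ![-2 * a 0 / 10, -2 * a 1 / 10, -2 * a 2 / 10, -a 0 / 10, -a 1 / 10, -a 2 / 10]

/-- The characteristic `(a₁, a₂, a₃)` is `σ`-invariant: `σ (a, b) ≡ (a, b)` modulo `ℤ`.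
By `isSigmaInvariant_iff` below this means that `a₁, a₂, a₃` are odd. -/
def IsSigmaInvariant (a : Fin 3 → ℤ) : Prop :=
  (∀ i, ∃ m : ℤ, actFst sigma (charA a) (charB a) i = charA a i + m) ∧
    ∀ i, ∃ m : ℤ, actSnd sigma (charA a) (charB a) i = charB a i + m

theorem isSigmaInvariant_iff (a : Fin 3 → ℤ) :
    IsSigmaInvariant a ↔ ∀ i, Odd (a i) := by
  constructor
  · rintro ⟨-, h⟩ i
    have key : ∀ x m : ℤ, (x : ℝ) + 1 = 2 * m → Odd x := by
      intro x m hm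
      have h' : x + 1 = 2 * m := by exact_mod_cast hm
      exact ⟨m - 1, by omega⟩
    fin_cases i
    · obtain ⟨m, hm⟩ := h 0
      simp [actSnd, sigma, charA, charB, Matrix.mulVec, dotProduct, Fin.sum_univ_six,
        Matrix.mul_apply] at hm
      exact key (a 0) m (by linarith)
    · obtain ⟨m, hm⟩ := h 1
      simp [actSnd, sigma, charA, charB, Matrix.mulVec, dotProduct, Fin.sum_univ_six,
        Matrix.mul_apply] at hm
      exact key (a 1) m (by linarith)
    · obtain ⟨m, hm⟩ := h 2
      simp [actSnd, sigma, charA, charB, Matrix.mulVec, dotProduct, Fin.sum_univ_six,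
        Matrix.mul_apply] at hm
      exact key (a 2) m (by linarith)
  · intro h
    choose k hk using h
    have hk' : ∀ i, (a i : ℝ) = 2 * k i + 1 := fun i => by rw [hk i]; push_cast; ring
    constructor
    · intro i
      refine ⟨0, ?_⟩
      fin_cases i <;>
        simp [actFst, sigma, charA, charB, Matrix.mulVec, dotProduct, Fin.sum_univ_six,
          Matrix.mul_apply] <;> ring
    · intro i
      refine ⟨![k 0 + 1, k 1 + 1, k 2 + 1, k 0 + 1, k 1 + 1, 0] i, ?_⟩
      fin_cases i <;>
        simp [actSnd, sigma, charA, charB, Matrix.mulVec, dotProduct, Fin.sum_univ_six,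
          Matrix.mul_apply, hk'] <;> ring

/-! ### The complex ball and the period matrices -/

/-- `ζ = exp (2 π i / 5)`. -/
def zeta : ℂ := Complex.exp (2 * Real.pi * Complex.I / 5)

/-- The Hermitian form `ᵗη̄ A η` for `A = diag (1, 1, (1 - √5) / 2)`. -/
def hermForm (v : Fin 3 → ℂ) : ℝ :=
  ‖v 0‖ ^ 2 + ‖v 1‖ ^ 2 + (1 - Real.sqrt 5) / 2 * ‖v 2‖ ^ 2

theorem hermForm_smul (t : ℂ) (v : Fin 3 → ℂ) : hermForm (t • v) = ‖t‖ ^ 2 * hermForm v := by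
  simp only [hermForm, Pi.smul_apply, smul_eq_mul, norm_mul]
  ring

/-- The complex ball `𝔹₂ᴬ = {η ∈ ℙ² : ᵗη̄ A η < 0}`. -/
def ball : Set (ℙ ℂ (Fin 3 → ℂ)) :=
  {p | Projectivization.lift (fun v : {v : Fin 3 → ℂ // v ≠ 0} => hermForm v.1 < 0)
    (by
      rintro ⟨v, hv⟩ ⟨w, hw⟩ t h
      have h' : v = t • w := h
      have ht : t ≠ 0 := by
        rintro rfl
        exact hv (by simpa using h')
      have hpos : 0 < ‖t‖ ^ 2 := by positivity
      simp only [h', hermForm_smul, eq_iff_iff]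
      constructor
      · intro hlt
        by_contra hge
        have := mul_nonneg hpos.le (not_lt.mp hge)
        linarith
      · exact fun hlt => mul_neg_of_pos_of_neg hpos hlt) p}

/-- The common denominator `Δ = η₁² + η₂² - ζ³ (1 + ζ) η₃²` of the entries of `Ω(η)`. -/
def periodDen (v : Fin 3 → ℂ) : ℂ :=
  v 0 ^ 2 + v 1 ^ 2 - zeta ^ 3 * (1 + zeta) * v 2 ^ 2

/-- The numerators of the entries of `Ω(η)` (a symmetric matrix). -/
def periodNum (v : Fin 3 → ℂ) : Matrix (Fin 6) (Fin 6) ℂ :=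
  let ζ := zeta
  let x := v 0
  let y := v 1
  let z := v 2
  let n11 := (ζ ^ 3 - 1) * (x ^ 2 + (1 + ζ ^ 3) * y ^ 2 + z ^ 2)
  let n22 := (ζ ^ 3 - 1) * ((1 + ζ ^ 3) * x ^ 2 + y ^ 2 + z ^ 2)
  let n33 := (ζ ^ 2 - 1) * (x ^ 2 + y ^ 2 - ζ ^ 3 * z ^ 2)
  let n44 := -ζ ^ 2 * (x ^ 2 + ζ ^ 2 * y ^ 2 - (1 + ζ) * z ^ 2)
  let n55 := -ζ ^ 2 * (ζ ^ 2 * x ^ 2 + y ^ 2 - (1 + ζ) * z ^ 2)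
  let n66 := -ζ ^ 3 * (x ^ 2 + y ^ 2 - (1 + ζ ^ 4) * z ^ 2)
  let n12 := (ζ ^ 3 - ζ) * x * y
  let n45 := (ζ ^ 4 - ζ ^ 2) * x * y
  let n15 := (ζ ^ 4 - ζ) * x * y
  let n24 := (ζ ^ 4 - ζ) * x * y
  let n13 := (1 - ζ ^ 2) * x * z
  let n23 := (1 - ζ ^ 2) * y * z
  let n46 := (ζ ^ 4 - ζ) * x * z
  let n56 := (ζ ^ 4 - ζ) * y * z
  let n16 := (ζ ^ 3 - ζ) * x * z
  let n26 := (ζ ^ 3 - ζ) * y * z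
  let n34 := (1 - ζ ^ 3) * x * z
  let n35 := (1 - ζ ^ 3) * y * z
  let n14 := ζ ^ 3 * ((1 + ζ) * x ^ 2 + (1 + ζ ^ 3) * y ^ 2 + z ^ 2)
  let n25 := ζ ^ 3 * ((1 + ζ ^ 3) * x ^ 2 + (1 + ζ) * y ^ 2 + z ^ 2)
  let n36 := (ζ + ζ ^ 2) * (x ^ 2 + y ^ 2 - ζ ^ 3 * (1 + ζ ^ 2) * z ^ 2)
  !![n11, n12, n13, n14, n15, n16;
     n12, n22, n23, n24, n25, n26;
     n13, n23, n33, n34, n35, n36;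
     n14, n24, n34, n44, n45, n46;
     n15, n25, n35, n45, n55, n56;
     n16, n26, n36, n46, n56, n66]

theorem periodDen_smul (t : ℂ) (v : Fin 3 → ℂ) : periodDen (t • v) = t ^ 2 * periodDen v := by
  simp only [periodDen, Pi.smul_apply, smul_eq_mul]
  ring

theorem periodNum_smul (t : ℂ) (v : Fin 3 → ℂ) : periodNum (t • v) = t ^ 2 • periodNum v := by
  ext i j
  fin_cases i <;> fin_cases j <;> simp [periodNum] <;> ring

/-- The period matrix `Ω(η)`, for `η ∈ ℙ²` (its denominator does not vanish on the ball). -/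
def periodMatrix : ℙ ℂ (Fin 3 → ℂ) → Matrix (Fin 6) (Fin 6) ℂ :=
  Projectivization.lift
    (fun v : {v : Fin 3 → ℂ // v ≠ 0} => (periodDen v.1)⁻¹ • periodNum v.1)
    (by
      rintro ⟨v, hv⟩ ⟨w, hw⟩ t h
      have h' : v = t • w := h
      have ht : t ≠ 0 := by
        rintro rfl
        exact hv (by simpa using h')
      have ht2 : t ^ 2 ≠ 0 := pow_ne_zero 2 ht
      simp only [h', periodDen_smul, periodNum_smul, smul_smul]
      rw [mul_inv, mul_right_comm, inv_mul_cancel₀ ht2, one_mul])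

/-- The zero locus `ϑ(a₁, a₂, a₃) = {η ∈ 𝔹₂ᴬ : Θ_{(a₁,a₂,a₃)}(Ω(η)) = 0}`. -/
def vartheta (a : Fin 3 → ℤ) : Set (ℙ ℂ (Fin 3 → ℂ)) :=
  {p | p ∈ ball ∧ thetaConst (charA a) (charB a) (periodMatrix p) = 0}

/-! ### The remaining characteristics modulo 10 -/

/-- The list of 25 triples of odd residues modulo 10. -/
def remaining : Finset (Fin 3 → ℤ) :=
  {![1, 1, 1], ![1, 1, 9], ![1, 9, 1], ![9, 1, 1], ![1, 3, 5], ![1, 7, 5],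
   ![3, 1, 5], ![7, 1, 5], ![3, 3, 3], ![3, 3, 7], ![3, 7, 3], ![7, 3, 3],
   ![9, 9, 9], ![9, 9, 1], ![9, 1, 9], ![1, 9, 9], ![9, 7, 5], ![9, 3, 5],
   ![7, 9, 5], ![3, 9, 5], ![7, 7, 7], ![7, 7, 3], ![7, 3, 7], ![3, 7, 7],
   ![5, 5, 5]}

end

end PentagonalTheta

/-! The matrix σ fixes every Ω(η), so the transformation formula of theta constants under σ relates
Θ at a σ-invariant characteristic to itself. With Q = 2a₁² + 2a₂² + a₃² it reads Θ = κ exp(πiQ/20)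
Θ, where κ² = -i (`thetaConst_functional_equation`). If Θ ≠ 0, the multiplier is 1; squaring gives
exp(πiQ/10) = i, that is Q ≡ 5 mod 20. Hence Θ vanishes as soon as 5 does not divide Q.

Geometry. The graph {(Ωw, w)} in ℂ¹² is described through its σ-eigencomponents (`IsPeriodVec`): the
ζ-component is free, the ζ²-component lies in a plane, the ζ³-component on a line, and the
ζ⁴-component is zero, so the dimensions are 3 + 2 + 1 + 0 = 6. The form Im(w̄·X) is diagonal in the
eigencomponents, with signatures (3,0), (2,1), (1,2), (0,3) (`five_mul_im_eq`), and the ball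
inequality makes it positive definite on this subspace (`IsPeriodVec.eq_zero_of_im_nonpos`).
Consequently Im Ω > 0, the theta series converges, and the subspace is exactly the graph. Since the
defining conditions are σ-stable, σ maps the graph to itself (`sigmaFst_periodMat`). The eigenvalues
of CΩ + D are ζ, ζ, ζ, ζ³, ζ², ζ², with product 1 (`automorphy_det`).

Analysis. The lower left block C of σ has rank 5, so the formula is Poisson summation in five of the
six coordinates. The inversion formula in several variables follows from the one-variable Jacobi
formula by bordering matrices (`HasInversion.border`); only the square of the constant is recorded,
which avoids choosing branches of square roots. The dual series is then matched with the original
one term by term (`dual_summand`), the oddness of the aᵢ making the exponents agree modulo 2πi.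

The list of 25 triples is a finite check on residues modulo 10. -/

namespace PentagonalTheta

/-! ### Gaussian sums over lattices -/

/-- The underlying complex vector of an integral vector. -/
def intVec {ι : Type*} (n : ι → ℤ) : ι → ℂ := fun i => n i

/-- Points of the Siegel upper half space, positivity being stated on complex vectors. -/
structure IsSiegel {ι : Type*} [Fintype ι] (Ω : Matrix ι ι ℂ) : Prop where
  symm : Ωᵀ = Ω
  pos : ∀ u : ι → ℂ, u ≠ 0 → 0 < (star u ⬝ᵥ Ω *ᵥ u).im

/-- Compactness of the unit sphere and homogeneity give Re q ≤ -ε‖v‖² and Re l ≤ d‖v‖, and the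
Gaussian is then compared with a power of ‖n‖⁻¹ summable over the lattice. Stating this for abstract
homogeneous q and l lets it serve the series for Ω, for Ω⁻¹, and the mixed series in which only a
block is inverted. -/
theorem summable_cexp_of_homogeneous {ι : Type*} [Fintype ι] (q l : (ι → ℝ) → ℂ) (c : ℂ)
    (hq : Continuous q) (hq2 : ∀ (t : ℝ) v, q (t • v) = t ^ 2 * q v)
    (hqn : ∀ v, v ≠ 0 → (q v).re < 0)
    (hl : Continuous l) (hl1 : ∀ (t : ℝ) v, l (t • v) = t * l v) :
    Summable fun n : ι → ℤ => Complex.exp (q (fun i => n i) + l (fun i => n i) + c) := by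
  classical
  have hq0 : q 0 = 0 := by simpa using hq2 0 0
  have hl0 : l 0 = 0 := by simpa using hl1 0 0
  obtain ⟨ε, hε, hqε⟩ : ∃ ε : ℝ, 0 < ε ∧ ∀ v, (q v).re ≤ -ε * ‖v‖ ^ 2 := by
    rcases isEmpty_or_nonempty ι with hι | hι
    · refine ⟨1, one_pos, fun v => ?_⟩
      rw [Subsingleton.elim v 0, hq0]
      simp
    obtain ⟨w, hw, hmax⟩ := (isCompact_sphere (0 : ι → ℝ) 1).exists_isMaxOn
      (NormedSpace.sphere_nonempty.mpr zero_le_one)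
      (f := fun v => (q v).re) (Complex.continuous_re.comp hq).continuousOn
    have hw1 : ‖w‖ = 1 := by simpa using hw
    have hw0 : w ≠ 0 := by rintro rfl; simp at hw1
    refine ⟨-(q w).re, by linarith [hqn w hw0], fun v => ?_⟩
    rcases eq_or_ne v 0 with rfl | hv
    · rw [hq0]
      simp
    · have hv' : ‖v‖ ≠ 0 := norm_ne_zero_iff.mpr hv
      have h1 : (q (‖v‖⁻¹ • v)).re ≤ (q w).re :=
        hmax (by simp [norm_smul, hv'])
      have h2 : v = ‖v‖ • (‖v‖⁻¹ • v) := by simp [smul_smul, hv']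
      have h3 : (q v).re = ‖v‖ ^ 2 * (q (‖v‖⁻¹ • v)).re := by
        conv_lhs => rw [h2, hq2]
        rw [← Complex.ofReal_pow, Complex.re_ofReal_mul]
      rw [h3, neg_neg, mul_comm]
      gcongr
  obtain ⟨d, hd, hld⟩ : ∃ d : ℝ, 0 ≤ d ∧ ∀ v, (l v).re ≤ d * ‖v‖ := by
    rcases isEmpty_or_nonempty ι with hι | hι
    · refine ⟨0, le_rfl, fun v => ?_⟩
      rw [Subsingleton.elim v 0, hl0]
      simp
    obtain ⟨w, hw, hmax⟩ := (isCompact_sphere (0 : ι → ℝ) 1).exists_isMaxOn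
      (NormedSpace.sphere_nonempty.mpr zero_le_one)
      (f := fun v => (l v).re) (Complex.continuous_re.comp hl).continuousOn
    refine ⟨|(l w).re|, abs_nonneg _, fun v => ?_⟩
    rcases eq_or_ne v 0 with rfl | hv
    · rw [hl0]
      simp
    · have hv' : ‖v‖ ≠ 0 := norm_ne_zero_iff.mpr hv
      have h1 : (l (‖v‖⁻¹ • v)).re ≤ (l w).re :=
        hmax (by simp [norm_smul, hv'])
      have h2 : v = ‖v‖ • (‖v‖⁻¹ • v) := by simp [smul_smul, hv']
      have h3 : (l v).re = ‖v‖ * (l (‖v‖⁻¹ • v)).re := by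
        conv_lhs => rw [h2, hl1]
        rw [Complex.re_ofReal_mul]
      rw [h3, mul_comm]
      gcongr
      exact h1.trans (le_abs_self _)
  obtain ⟨k, hk⟩ : ∃ k : ℕ, Summable fun n : ι → ℤ => (‖(fun i => (n i : ℝ))‖⁻¹) ^ k := by
    let b := Pi.basisFun ℝ ι
    let L := Submodule.span ℤ (Set.range b)
    -- Any exponent larger than the rank of the lattice works.
    refine ⟨Module.finrank ℤ L + 1, ?_⟩
    have := ZLattice.summable_norm_pow_inv L (Module.finrank ℤ L + 1) (Nat.lt_succ_self _)
    have hmem : ∀ n : ι → ℤ, (fun i => (n i : ℝ)) ∈ L := fun n =>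
      b.mem_span_iff_repr_mem ℤ _ |>.mpr fun i => ⟨n i, by simp [b]⟩
    refine this.comp_injective (i := fun n => (⟨_, hmem n⟩ : L)) ?_
    intro m n h
    have h' := congrArg Subtype.val h
    funext i
    exact Int.cast_injective (α := ℝ) (congrFun h' i)
  have key : Filter.Tendsto (fun t : ℝ => t ^ k * Real.exp (-ε * t ^ 2 + d * t))
      Filter.atTop (nhds 0) := by
    have h1 := Real.tendsto_pow_mul_exp_neg_atTop_nhds_zero k
    refine squeeze_zero' ?_ ?_ h1
    · filter_upwards [Filter.eventually_ge_atTop 0] with t ht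
      positivity
    -- Beyond (d + 1)/ε one has -εt² + dt ≤ -t.
    · filter_upwards [Filter.eventually_ge_atTop 0, Filter.eventually_ge_atTop ((d + 1) / ε)]
        with t ht ht'
      rw [div_le_iff₀ hε] at ht'
      gcongr
      nlinarith
  obtain ⟨T, hT⟩ := Filter.eventually_atTop.mp (key.eventually (ge_mem_nhds one_pos))
  -- Beyond T the comparison holds; the bound 1 keeps the norm positive, so that one may divide by
  -- it.
  have hfin : {n : ι → ℤ | ¬ (max T 1 ≤ ‖(fun i => (n i : ℝ))‖)}.Finite := by
    refine (Set.Finite.pi' (t := fun _ : ι => Set.Icc (-⌈max T 1⌉) ⌈max T 1⌉)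
      (fun _ => Set.finite_Icc _ _)).subset ?_
    intro n hn i
    simp only [Set.mem_ofPred_eq, not_le] at hn
    have h1 : |(n i : ℝ)| ≤ ‖(fun i => (n i : ℝ))‖ := by
      simpa using norm_le_pi_norm (fun i => (n i : ℝ)) i
    have h2 := abs_le.mp (h1.trans (hn.le.trans (Int.le_ceil _)))
    constructor
    · exact_mod_cast h2.1
    · exact_mod_cast h2.2
  refine Summable.of_norm_bounded_eventually (hk.mul_left (Real.exp c.re)) ?_
  rw [Filter.eventually_cofinite]
  refine hfin.subset fun n hn => ?_
  simp only [Set.mem_ofPred_eq] at hn ⊢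
  contrapose! hn
  set v : ι → ℝ := fun i => (n i : ℝ)
  have h1 := hT ‖v‖ ((le_max_left _ _).trans hn)
  have hv : 0 < ‖v‖ := lt_of_lt_of_le one_pos ((le_max_right _ _).trans hn)
  have h2 : Real.exp (-ε * ‖v‖ ^ 2 + d * ‖v‖) ≤ (‖v‖⁻¹) ^ k := by
    rw [inv_pow, ← one_div, le_div_iff₀ (by positivity), mul_comm]
    exact h1
  rw [Complex.norm_exp, Complex.add_re, Complex.add_re, add_comm, Real.exp_add]
  gcongr
  refine le_trans (Real.exp_le_exp.mpr ?_) h2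
  exact add_le_add (hqε v) (hld v)

open Complex (I)
open scoped ComplexConjugate

/-! ### Points of the Siegel upper half space -/

theorem dotProduct_mulVec_comm_of_symm {ι : Type*} [Fintype ι] {Ω : Matrix ι ι ℂ}
    (h : Ωᵀ = Ω) (u v : ι → ℂ) : u ⬝ᵥ Ω *ᵥ v = v ⬝ᵥ Ω *ᵥ u := by
  rw [Matrix.dotProduct_mulVec, ← Matrix.mulVec_transpose, h, dotProduct_comm]

namespace IsSiegel

variable {ι : Type*} [Fintype ι] {Ω : Matrix ι ι ℂ}

theorem eq_zero_of_mulVec (h : IsSiegel Ω) {u : ι → ℂ} (hu : Ω *ᵥ u = 0) : u = 0 := by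
  by_contra h0
  have := h.pos u h0
  simp [hu] at this

theorem isUnit_det [DecidableEq ι] (h : IsSiegel Ω) : IsUnit Ω.det := by
  rw [isUnit_iff_ne_zero]
  intro h0
  obtain ⟨v, hv, hv0⟩ := Matrix.exists_mulVec_eq_zero_iff.mpr h0
  exact hv (h.eq_zero_of_mulVec hv0)

theorem mulVec_inv [DecidableEq ι] (h : IsSiegel Ω) (v : ι → ℂ) : Ω *ᵥ (Ω⁻¹ *ᵥ v) = v := by
  rw [Matrix.mulVec_mulVec, Matrix.mul_nonsing_inv _ h.isUnit_det, Matrix.one_mulVec]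

theorem inv_mulVec [DecidableEq ι] (h : IsSiegel Ω) (v : ι → ℂ) : Ω⁻¹ *ᵥ (Ω *ᵥ v) = v := by
  rw [Matrix.mulVec_mulVec, Matrix.nonsing_inv_mul _ h.isUnit_det, Matrix.one_mulVec]

theorem inv_symm [DecidableEq ι] (h : IsSiegel Ω) : (Ω⁻¹)ᵀ = Ω⁻¹ := by
  rw [Matrix.transpose_nonsing_inv, h.symm]

theorem submatrix {κ : Type*} [Fintype κ] (h : IsSiegel Ω) {f : κ → ι}
    (hf : Function.Injective f) : IsSiegel (Ω.submatrix f f) where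
  symm := by rw [Matrix.transpose_submatrix, h.symm]
  pos u hu := by
    classical
    have hex : ∀ i, Function.extend f u 0 (f i) = u i := fun i => hf.extend_apply u 0 i
    have hex' : ∀ j ∉ Set.range f, Function.extend f u 0 j = 0 := fun j hj =>
      Function.extend_apply' _ _ _ (by simpa using hj)
    have hne : Function.extend f u 0 ≠ 0 := by
      intro h0
      refine hu (funext fun i => ?_)
      rw [← hex i, h0]
      rfl
    convert h.pos _ hne using 2
    refine Fintype.sum_of_injective f hf _ _ (fun j hj => ?_) fun i => ?_
    · simp [hex' j hj]
    · simp only [Pi.star_apply, hex]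
      congr 1
      refine Fintype.sum_of_injective f hf _ _ (fun j hj => ?_) fun i => ?_
      · simp [hex' j hj]
      · simp [hex]

theorem reindex {κ : Type*} [Fintype κ] (h : IsSiegel Ω) (e : κ ≃ ι) :
    IsSiegel (Ω.submatrix e e) :=
  h.submatrix e.injective

/-- On real vectors the imaginary part of the inverse form is negative. -/
theorem im_inv_neg [DecidableEq ι] (h : IsSiegel Ω) (v : ι → ℝ) (hv : v ≠ 0) :
    ((fun i => (v i : ℂ)) ⬝ᵥ Ω⁻¹ *ᵥ (fun i => (v i : ℂ))).im < 0 := by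
  set w : ι → ℂ := fun i => (v i : ℂ)
  set u := Ω⁻¹ *ᵥ w with hu
  have hu0 : u ≠ 0 := by
    intro h0
    have h1 := h.mulVec_inv w
    rw [← hu, h0, Matrix.mulVec_zero] at h1
    exact hv (funext fun i => by simpa [w] using (congrFun h1 i).symm)
  have h1 := h.pos u hu0
  rw [hu, h.mulVec_inv w, ← hu] at h1
  have h2 : star u ⬝ᵥ w = star (w ⬝ᵥ u) := by
    simp [dotProduct, w, mul_comm]
  rw [h2, Complex.star_def, Complex.conj_im] at h1
  linarith

theorem im_pos_real (h : IsSiegel Ω) (v : ι → ℝ) (hv : v ≠ 0) :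
    0 < ((fun i => (v i : ℂ)) ⬝ᵥ Ω *ᵥ (fun i => (v i : ℂ))).im := by
  have h1 : (fun i => (v i : ℂ)) ≠ 0 := fun h0 =>
    hv (funext fun i => by simpa using congrFun h0 i)
  have h2 : star (fun i => (v i : ℂ)) = (fun i => (v i : ℂ)) := by
    ext i
    simp
  simpa [h2] using h.pos _ h1

end IsSiegel

theorem re_pi_I_mul_neg {c : ℂ} (hc : 0 < c.im) : (Real.pi * I * c).re < 0 := by
  have : (Real.pi * I * c).re = -(Real.pi * c.im) := by simp
  rw [this, neg_lt_zero]
  positivity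

theorem ofReal_smul_vec {ι : Type*} (t : ℝ) (v : ι → ℝ) :
    (fun i => (((t • v) i : ℝ) : ℂ)) = (t : ℂ) • fun i => (v i : ℂ) := by
  ext i
  simp

theorem IsSiegel.summable_inv {ι : Type*} [Fintype ι] [DecidableEq ι] {Ω : Matrix ι ι ℂ}
    (h : IsSiegel Ω) (z : ι → ℂ) :
    Summable fun m : ι → ℤ => Complex.exp
      (-(Real.pi * I * ((z + intVec m) ⬝ᵥ Ω⁻¹ *ᵥ (z + intVec m)))) := by
  refine (summable_cexp_of_homogeneous
    (fun v => Real.pi * I * (-((fun i => (v i : ℂ)) ⬝ᵥ Ω⁻¹ *ᵥ (fun i => (v i : ℂ)))))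
    (fun v => -(2 * Real.pi * I * (z ⬝ᵥ Ω⁻¹ *ᵥ (fun i => (v i : ℂ)))))
    (-(Real.pi * I * (z ⬝ᵥ Ω⁻¹ *ᵥ z))) (by fun_prop) ?_ ?_ (by fun_prop) ?_).congr ?_
  · intro t v
    simp only [ofReal_smul_vec, Matrix.mulVec_smul, smul_dotProduct, dotProduct_smul, smul_eq_mul]
    ring
  · intro v hv
    exact re_pi_I_mul_neg (by simpa using h.im_inv_neg v hv)
  · intro t v
    simp only [ofReal_smul_vec, Matrix.mulVec_smul, dotProduct_smul, smul_eq_mul]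
    ring
  · intro m
    congr 1
    have : (fun i => (((m i : ℤ) : ℝ) : ℂ)) = intVec m := by ext i; simp [intVec]
    simp only [this, Matrix.mulVec_add, dotProduct_add, add_dotProduct]
    rw [dotProduct_mulVec_comm_of_symm h.inv_symm (intVec m) z]
    ring

theorem IsSiegel.summable_add {ι : Type*} [Fintype ι] {Ω : Matrix ι ι ℂ}
    (h : IsSiegel Ω) (a z : ι → ℂ) :
    Summable fun n : ι → ℤ => Complex.exp
      (Real.pi * I * ((intVec n + a) ⬝ᵥ Ω *ᵥ (intVec n + a))
        + 2 * Real.pi * I * ((intVec n + a) ⬝ᵥ z)) := by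
  refine (summable_cexp_of_homogeneous
    (fun v => Real.pi * I * ((fun i => (v i : ℂ)) ⬝ᵥ Ω *ᵥ (fun i => (v i : ℂ))))
    (fun v => 2 * Real.pi * I * (a ⬝ᵥ Ω *ᵥ (fun i => (v i : ℂ)) + (fun i => (v i : ℂ)) ⬝ᵥ z))
    (Real.pi * I * (a ⬝ᵥ Ω *ᵥ a) + 2 * Real.pi * I * (a ⬝ᵥ z))
    (by fun_prop) ?_ ?_ (by fun_prop) ?_).congr ?_
  · intro t v
    simp only [ofReal_smul_vec, Matrix.mulVec_smul, smul_dotProduct, dotProduct_smul, smul_eq_mul]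
    ring
  · intro v hv
    exact re_pi_I_mul_neg (h.im_pos_real v hv)
  · intro t v
    simp only [ofReal_smul_vec, Matrix.mulVec_smul, smul_dotProduct, dotProduct_smul, smul_eq_mul]
    ring
  · intro m
    congr 1
    have : (fun i => (((m i : ℤ) : ℝ) : ℂ)) = intVec m := by ext i; simp [intVec]
    simp only [this, Matrix.mulVec_add, dotProduct_add, add_dotProduct]
    rw [dotProduct_mulVec_comm_of_symm h.symm (intVec m) a]
    ring

/-! ### The inversion formula -/

/-- The inversion formula for Gaussian sums attached to `Ω`, with a constant whose square is
explicit. -/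
def HasInversion {ι : Type*} [Fintype ι] [DecidableEq ι] (Ω : Matrix ι ι ℂ) : Prop :=
  ∃ κ : ℂ, κ ^ 2 * Ω.det = I ^ Fintype.card ι ∧ ∀ z : ι → ℂ,
    ∑' n : ι → ℤ, Complex.exp (Real.pi * I * (intVec n ⬝ᵥ Ω *ᵥ intVec n)
      + 2 * Real.pi * I * (intVec n ⬝ᵥ z)) =
    κ * ∑' m : ι → ℤ, Complex.exp
      (-(Real.pi * I * ((z + intVec m) ⬝ᵥ Ω⁻¹ *ᵥ (z + intVec m))))

/-- Jacobi's functional equation for `jacobiTheta₂`, with the Gaussian prefactor absorbed by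
completing the square. -/
theorem inversion_one {s : ℂ} (hs : 0 < s.im) : ∃ κ : ℂ, κ ^ 2 * s = I ∧ ∀ w : ℂ,
    ∑' n : ℤ, Complex.exp (Real.pi * I * (s * n ^ 2) + 2 * Real.pi * I * (n * w)) =
    κ * ∑' m : ℤ, Complex.exp (-(Real.pi * I * ((w + m) ^ 2 / s))) := by
  have hs0 : s ≠ 0 := by rintro rfl; simp at hs
  refine ⟨1 / (-I * s) ^ (1 / 2 : ℂ), ?_, fun w => ?_⟩
  · have h1 : ((-I * s) ^ (1 / 2 : ℂ)) ^ 2 = -I * s := by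
      rw [← Complex.cpow_nat_mul]
      norm_num
    rw [div_pow, h1, one_pow]
    have := Complex.I_ne_zero
    field_simp
    simp
  · have h := jacobiTheta₂_functional_equation w s
    rw [jacobiTheta₂, jacobiTheta₂, mul_assoc, ← tsum_mul_left] at h
    refine Eq.trans (tsum_congr fun n => ?_) (h.trans ?_)
    · rw [jacobiTheta₂_term]
      congr 1
      ring
    · congr 1
      -- Completing the square produces (w - n)², so the summation index changes sign.
      rw [← (Equiv.neg ℤ).tsum_eq (fun n => Complex.exp (-Real.pi * I * w ^ 2 / s) * _)]
      refine tsum_congr fun n => ?_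
      rw [jacobiTheta₂_term, ← Complex.exp_add]
      congr 1
      push_cast [Equiv.neg_apply]
      field_simp
      ring

theorem HasInversion.reindex {ι κ : Type*} [Fintype ι] [DecidableEq ι] [Fintype κ] [DecidableEq κ]
    {Ω : Matrix ι ι ℂ} (e : κ ≃ ι) (h : HasInversion (Ω.submatrix e e)) : HasInversion Ω := by
  obtain ⟨c, hc, hsum⟩ := h
  refine ⟨c, by rwa [Matrix.det_submatrix_equiv_self, Fintype.card_congr e] at hc, fun z => ?_⟩
  have key := hsum (z ∘ e)
  rw [← (e.arrowCongr (Equiv.refl ℤ)).tsum_eq, ← (e.arrowCongr (Equiv.refl ℤ)).tsum_eq]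
  have hv : ∀ n : κ → ℤ, intVec (e.arrowCongr (Equiv.refl ℤ) n) ∘ e = intVec n := by
    intro n
    ext i
    simp [intVec, Equiv.arrowCongr]
  have hdot : ∀ u v : ι → ℂ, u ⬝ᵥ v = (u ∘ e) ⬝ᵥ (v ∘ e) := fun u v =>
    (comp_equiv_dotProduct_comp_equiv u v e).symm
  have hmul : ∀ (M : Matrix ι ι ℂ) (u : ι → ℂ), (M *ᵥ u) ∘ e = M.submatrix e e *ᵥ (u ∘ e) := by
    intro M u
    rw [Matrix.submatrix_mulVec_equiv]
    simp [Function.comp_assoc]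
  simp only [hdot _ z, hdot _ (Ω *ᵥ _), hdot _ (Ω⁻¹ *ᵥ _), hmul, hv]
  have hv' : ∀ n : κ → ℤ, (z + intVec (e.arrowCongr (Equiv.refl ℤ) n)) ∘ e
      = z ∘ e + intVec n := by
    intro n
    rw [← hv n]
    rfl
  simp only [hv', ← Matrix.inv_submatrix_equiv]
  exact key

/-! ### Bordered matrices and the induction step for inversion -/

/-- A block matrix with a border of width one. -/
def border {p : Type*} (A : Matrix p p ℂ) (w : p → ℂ) (τ : ℂ) : Matrix (p ⊕ Unit) (p ⊕ Unit) ℂ :=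
  Matrix.fromBlocks A (Matrix.of fun i _ => w i) (Matrix.of fun _ j => w j)
    (Matrix.of fun _ _ => τ)

theorem border_mulVec {p : Type*} [Fintype p] (A : Matrix p p ℂ) (w u : p → ℂ) (τ t : ℂ) :
    border A w τ *ᵥ Sum.elim u (fun _ => t) =
      Sum.elim (A *ᵥ u + t • w) (fun _ => w ⬝ᵥ u + τ * t) := by
  ext (i | i)
  · simp [border, Matrix.mulVec, dotProduct, mul_comm]
  · simp [border, Matrix.mulVec, dotProduct]

theorem elim_dotProduct {p : Type*} [Fintype p] (u v : p → ℂ) (s t : ℂ) :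
    Sum.elim u (fun _ : Unit => s) ⬝ᵥ Sum.elim v (fun _ => t) = u ⬝ᵥ v + s * t := by
  simp [dotProduct]

theorem exists_eq_border {p : Type*} {Ω : Matrix (p ⊕ Unit) (p ⊕ Unit) ℂ} (h : Ωᵀ = Ω) :
    ∃ A w τ, Ω = border A w τ := by
  refine ⟨Ω.toBlocks₁₁, fun i => Ω (.inl i) (.inr ()), Ω (.inr ()) (.inr ()), ?_⟩
  ext (i | i) (j | j)
  · rfl
  · rfl
  · exact congrFun (congrFun h (.inr i)) (.inl j) |>.symm
  · rfl

theorem tsum_swap {α β : Type*} {f : α × β → ℂ} (h : Summable f) :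
    ∑' a, ∑' b, f (a, b) = ∑' b, ∑' a, f (a, b) :=
  (Summable.tsum_comm (f := fun a b => f (a, b)) h).symm

section Border

variable {p : Type*} {A : Matrix p p ℂ} {w : p → ℂ} {τ : ℂ}

theorem IsSiegel.of_border [Fintype p] (h : IsSiegel (border A w τ)) : IsSiegel A :=
  h.submatrix Sum.inl_injective

/-- Integral vectors on an index set enlarged by one point. -/
def elimEquiv (p : Type*) : (p → ℤ) × ℤ ≃ (p ⊕ Unit → ℤ) where
  toFun x := Sum.elim x.1 fun _ => x.2
  invFun n := (fun i => n (.inl i), n (.inr ()))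
  left_inv _ := rfl
  right_inv n := by ext (i | i) <;> rfl

theorem elimEquiv_inl (x : (p → ℤ) × ℤ) (i : p) : elimEquiv p x (.inl i) = x.1 i := rfl

theorem elimEquiv_inr (x : (p → ℤ) × ℤ) (i : Unit) : elimEquiv p x (.inr i) = x.2 := rfl

theorem intVec_elimEquiv (x : (p → ℤ) × ℤ) :
    intVec (elimEquiv p x) = Sum.elim (intVec x.1) fun _ => (x.2 : ℂ) := by
  ext (i | i) <;> rfl

variable [Fintype p] [DecidableEq p]

/-- The Schur complement is the value of the form at the vector (-A⁻¹w, 1). -/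
theorem IsSiegel.schur_pos (h : IsSiegel (border A w τ)) :
    0 < (τ - w ⬝ᵥ A⁻¹ *ᵥ w).im := by
  have hA := h.of_border
  have h1 := h.pos (Sum.elim (-(A⁻¹ *ᵥ w)) fun _ => 1) fun h0 => by
    simpa using congrFun h0 (.inr ())
  rw [border_mulVec] at h1
  have h2 : A *ᵥ (-(A⁻¹ *ᵥ w)) + (1 : ℂ) • w = 0 := by
    rw [Matrix.mulVec_neg, hA.mulVec_inv, one_smul, neg_add_cancel]
  rw [h2] at h1
  have h3 : star (Sum.elim (-(A⁻¹ *ᵥ w)) fun _ : Unit => (1 : ℂ)) =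
      Sum.elim (star (-(A⁻¹ *ᵥ w))) fun _ => 1 := by
    ext (i | i) <;> simp
  rw [h3, elim_dotProduct] at h1
  convert h1 using 2
  simp
  ring

theorem border_det (h : IsSiegel (border A w τ)) :
    (border A w τ).det = A.det * (τ - w ⬝ᵥ A⁻¹ *ᵥ w) := by
  have := A.invertibleOfIsUnitDet h.of_border.isUnit_det
  rw [border, Matrix.det_fromBlocks₁₁, Matrix.invOf_eq_nonsing_inv, Matrix.mul_assoc,
    Matrix.det_unique (n := Unit)]
  rfl

theorem border_inv_form (h : IsSiegel (border A w τ)) (v : p → ℂ) (t : ℂ) :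
    Sum.elim v (fun _ => t) ⬝ᵥ (border A w τ)⁻¹ *ᵥ Sum.elim v (fun _ => t) =
      v ⬝ᵥ A⁻¹ *ᵥ v + (t - w ⬝ᵥ A⁻¹ *ᵥ v) ^ 2 / (τ - w ⬝ᵥ A⁻¹ *ᵥ w) := by
  have hA := h.of_border
  have hs : τ - w ⬝ᵥ A⁻¹ *ᵥ w ≠ 0 := by
    intro h0
    simpa [h0] using h.schur_pos
  set s := τ - w ⬝ᵥ A⁻¹ *ᵥ w with hsdef
  -- Block elimination: u0 is the last coordinate of the preimage of (v, t).
  set u0 := (t - w ⬝ᵥ A⁻¹ *ᵥ v) / s with hu0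
  have h1 : border A w τ *ᵥ Sum.elim (A⁻¹ *ᵥ (v - u0 • w)) (fun _ => u0) =
      Sum.elim v (fun _ => t) := by
    rw [border_mulVec, hA.mulVec_inv]
    congr 1
    · ext i
      simp
    · funext _
      have h2 : τ = s + w ⬝ᵥ A⁻¹ *ᵥ w := by rw [hsdef]; ring
      have h3 : u0 * s = t - w ⬝ᵥ A⁻¹ *ᵥ v := by rw [hu0]; field_simp
      simp only [Matrix.mulVec_sub, Matrix.mulVec_smul, dotProduct_sub, dotProduct_smul,
        smul_eq_mul]
      rw [h2]
      linear_combination h3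
  have h4 : (border A w τ)⁻¹ *ᵥ Sum.elim v (fun _ => t) =
      Sum.elim (A⁻¹ *ᵥ (v - u0 • w)) (fun _ => u0) := by
    rw [← h1, h.inv_mulVec]
  rw [h4, elim_dotProduct]
  simp only [Matrix.mulVec_sub, Matrix.mulVec_smul, dotProduct_sub, dotProduct_smul, smul_eq_mul]
  rw [dotProduct_mulVec_comm_of_symm hA.inv_symm v w, hu0]
  field_simp
  ring

/-- On real vectors the form obtained by inverting the block `A` only is positive. -/
theorem IsSiegel.im_partial_pos (h : IsSiegel (border A w τ)) (v : p → ℝ) (y : ℝ)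
    (hv : v ≠ 0 ∨ y ≠ 0) :
    0 < (τ * y ^ 2 - ((fun i => (v i : ℂ)) + (y : ℂ) • w) ⬝ᵥ
      A⁻¹ *ᵥ ((fun i => (v i : ℂ)) + (y : ℂ) • w)).im := by
  have hA := h.of_border
  set v' : p → ℂ := fun i => (v i : ℂ) with hv'
  set u := A⁻¹ *ᵥ (v' + (y : ℂ) • w) with hu
  have hAu : A *ᵥ u = v' + (y : ℂ) • w := hA.mulVec_inv _
  have hne : Sum.elim (-u) (fun _ : Unit => (y : ℂ)) ≠ 0 := by
    intro h0
    have hy : y = 0 := by simpa using congrFun h0 (.inr ())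
    have hu0 : u = 0 := by
      ext i
      simpa using congrFun h0 (.inl i)
    rw [hu0, hy] at hAu
    refine hv.elim (fun hv => hv (funext fun i => ?_)) (fun h => h hy)
    have := congrFun hAu i
    simpa [hv'] using this.symm
  have h1 := h.pos _ hne
  have h3 : star (Sum.elim (-u) fun _ : Unit => (y : ℂ)) = Sum.elim (star (-u)) fun _ => (y : ℂ) := by
    ext (i | i) <;> simp
  rw [border_mulVec, h3, elim_dotProduct, Matrix.mulVec_neg, hAu] at h1
  have h4 : star (-u) ⬝ᵥ (-(v' + (y : ℂ) • w) + (y : ℂ) • w) = star (u ⬝ᵥ v') := by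
    simp [dotProduct, hv', mul_comm]
  have h5 : (τ * y ^ 2 - (v' + (y : ℂ) • w) ⬝ᵥ u) =
      -(u ⬝ᵥ v') + (y : ℂ) * (w ⬝ᵥ (-u) + τ * y) := by
    rw [add_dotProduct, smul_dotProduct, dotProduct_neg, dotProduct_comm v', smul_eq_mul]
    ring
  rw [h4] at h1
  rw [h5]
  simpa using h1

/-- Absolute convergence of the intermediate double series, inverted in the block variables only; it
justifies exchanging the two summations in `HasInversion.border`. -/
theorem IsSiegel.summable_partial (h : IsSiegel (border A w τ)) (z : p → ℂ) (c : ℂ) :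
    Summable fun x : (p → ℤ) × ℤ => Complex.exp (Real.pi * I * (τ * x.2 ^ 2) +
      2 * Real.pi * I * (x.2 * c) - Real.pi * I * ((z + (x.2 : ℂ) • w + intVec x.1) ⬝ᵥ
        A⁻¹ *ᵥ (z + (x.2 : ℂ) • w + intVec x.1))) := by
  have hA := h.of_border
  have key := summable_cexp_of_homogeneous (ι := p ⊕ Unit)
    (fun v => Real.pi * I * (τ * (v (.inr ()) : ℂ) ^ 2 -
      ((fun i => (v (.inl i) : ℂ)) + (v (.inr ()) : ℂ) • w) ⬝ᵥ
        A⁻¹ *ᵥ ((fun i => (v (.inl i) : ℂ)) + (v (.inr ()) : ℂ) • w)))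
    (fun v => 2 * Real.pi * I * ((v (.inr ()) : ℂ) * c -
      z ⬝ᵥ A⁻¹ *ᵥ ((fun i => (v (.inl i) : ℂ)) + (v (.inr ()) : ℂ) • w)))
    (-(Real.pi * I * (z ⬝ᵥ A⁻¹ *ᵥ z))) (by fun_prop) ?_ ?_ (by fun_prop) ?_
  · rw [← (elimEquiv p).summable_iff] at key
    refine key.congr fun x => ?_
    simp only [Function.comp_apply]
    congr 1
    have : (fun i => (((elimEquiv p x (.inl i) : ℤ) : ℝ) : ℂ)) = intVec x.1 := by
      ext i
      simp [intVec, elimEquiv_inl]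
    rw [this]
    have : (((elimEquiv p x (.inr ()) : ℤ) : ℝ) : ℂ) = x.2 := by simp [elimEquiv_inr]
    rw [this]
    have h2 : z + (x.2 : ℂ) • w + intVec x.1 = z + (intVec x.1 + (x.2 : ℂ) • w) := by abel
    rw [h2]
    generalize intVec x.1 + (x.2 : ℂ) • w = u
    simp only [Matrix.mulVec_add, dotProduct_add, add_dotProduct]
    rw [dotProduct_mulVec_comm_of_symm hA.inv_symm u z]
    ring
  · intro t v
    have h1 : (fun i => (((t • v) (.inl i) : ℝ) : ℂ)) + (((t • v) (.inr ()) : ℝ) : ℂ) • w =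
        (t : ℂ) • ((fun i => (v (.inl i) : ℂ)) + (v (.inr ()) : ℂ) • w) := by
      ext i
      simp
      ring
    simp only [h1, Matrix.mulVec_smul, smul_dotProduct, dotProduct_smul, smul_eq_mul]
    simp
    ring
  · intro v hv
    refine re_pi_I_mul_neg (h.im_partial_pos (fun i => v (.inl i)) (v (.inr ())) ?_)
    by_contra! h0
    refine hv (funext fun i => ?_)
    rcases i with i | i
    · exact congrFun h0.1 i
    · exact h0.2
  · intro t v
    have h1 : (fun i => (((t • v) (.inl i) : ℝ) : ℂ)) + (((t • v) (.inr ()) : ℝ) : ℂ) • w =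
        (t : ℂ) • ((fun i => (v (.inl i) : ℂ)) + (v (.inr ()) : ℂ) • w) := by
      ext i
      simp
      ring
    simp only [h1, Matrix.mulVec_smul, dotProduct_smul, smul_eq_mul]
    simp
    ring

/-- For a fixed last coordinate, the sum over the block is inverted with A. After exchanging the
sums, what remains in the last coordinate is a one-variable Gaussian whose modulus is the Schur
complement. The constants multiply as the determinants do in `border_det`. -/
theorem HasInversion.border (h : IsSiegel (border A w τ)) (hI : HasInversion A) :
    HasInversion (border A w τ) := by
  obtain ⟨κ₁, hκ₁, hsum₁⟩ := hI
  obtain ⟨κ₀, hκ₀, hsum₀⟩ := inversion_one h.schur_pos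
  have hA := h.of_border
  refine ⟨κ₁ * κ₀, ?_, fun z => ?_⟩
  · rw [border_det h, Fintype.card_sum, Fintype.card_unit, pow_succ I, ← hκ₁]
    linear_combination κ₁ ^ 2 * A.det * hκ₀
  obtain ⟨z₁, c, rfl⟩ : ∃ (z₁ : p → ℂ) (c : ℂ), z = Sum.elim z₁ fun _ => c :=
    ⟨fun i => z (.inl i), z (.inr ()), by ext (i | i) <;> rfl⟩
  have hS₁ := h.summable_add 0 (Sum.elim z₁ fun _ => c)
  simp only [add_zero] at hS₁
  have hS₃ := h.summable_inv (Sum.elim z₁ fun _ => c)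
  have hS₂ := h.summable_partial z₁ c
  rw [← (elimEquiv p).summable_iff] at hS₁ hS₃
  rw [← (elimEquiv p).tsum_eq, ← (elimEquiv p).tsum_eq]
  have hT₁ : ∀ x : (p → ℤ) × ℤ, Real.pi * I * (intVec (elimEquiv p x) ⬝ᵥ
        PentagonalTheta.border A w τ *ᵥ intVec (elimEquiv p x)) +
        2 * Real.pi * I * (intVec (elimEquiv p x) ⬝ᵥ Sum.elim z₁ fun _ => c) =
      (Real.pi * I * (τ * x.2 ^ 2) + 2 * Real.pi * I * (x.2 * c)) +
        (Real.pi * I * (intVec x.1 ⬝ᵥ A *ᵥ intVec x.1) +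
          2 * Real.pi * I * (intVec x.1 ⬝ᵥ (z₁ + (x.2 : ℂ) • w))) := by
    intro x
    rw [intVec_elimEquiv, border_mulVec, elim_dotProduct, elim_dotProduct]
    simp only [dotProduct_add, dotProduct_smul, smul_eq_mul]
    rw [dotProduct_comm w]
    ring
  have hT₃ : ∀ x : (p → ℤ) × ℤ,
      (-(Real.pi * I * ((Sum.elim z₁ (fun _ => c) + intVec (elimEquiv p x)) ⬝ᵥ
        (PentagonalTheta.border A w τ)⁻¹ *ᵥ
          (Sum.elim z₁ (fun _ => c) + intVec (elimEquiv p x))))) =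
      -(Real.pi * I * ((z₁ + intVec x.1) ⬝ᵥ A⁻¹ *ᵥ (z₁ + intVec x.1))) +
       -(Real.pi * I * (((c - w ⬝ᵥ A⁻¹ *ᵥ (z₁ + intVec x.1)) + x.2) ^ 2 /
          (τ - w ⬝ᵥ A⁻¹ *ᵥ w))) := by
    intro x
    have h1 : (Sum.elim z₁ (fun _ => c) + intVec (elimEquiv p x) : p ⊕ Unit → ℂ) =
        Sum.elim (z₁ + intVec x.1) fun _ => c + x.2 := by
      rw [intVec_elimEquiv]
      ext (i | i) <;> simp
    rw [h1, border_inv_form h]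
    ring
  have hT₂ : ∀ x : (p → ℤ) × ℤ, (Real.pi * I * (τ * x.2 ^ 2) +
      2 * Real.pi * I * (x.2 * c) - Real.pi * I * ((z₁ + (x.2 : ℂ) • w + intVec x.1) ⬝ᵥ
        A⁻¹ *ᵥ (z₁ + (x.2 : ℂ) • w + intVec x.1))) =
      -(Real.pi * I * ((z₁ + intVec x.1) ⬝ᵥ A⁻¹ *ᵥ (z₁ + intVec x.1))) +
      (Real.pi * I * ((τ - w ⬝ᵥ A⁻¹ *ᵥ w) * x.2 ^ 2) +
        2 * Real.pi * I * (x.2 * (c - w ⬝ᵥ A⁻¹ *ᵥ (z₁ + intVec x.1)))) := by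
    intro x
    have h2 : z₁ + (x.2 : ℂ) • w + intVec x.1 = (z₁ + intVec x.1) + (x.2 : ℂ) • w := by abel
    rw [h2]
    generalize z₁ + intVec x.1 = u
    simp only [Matrix.mulVec_add, dotProduct_add, add_dotProduct, Matrix.mulVec_smul,
      dotProduct_smul, smul_dotProduct, smul_eq_mul]
    rw [dotProduct_mulVec_comm_of_symm hA.inv_symm u w]
    ring
  simp only [Function.comp_def, hT₁] at hS₁
  simp only [Function.comp_def, hT₃] at hS₃
  simp only [hT₁, hT₃]
  calc _ = ∑' (y : ℤ) (n : p → ℤ), Complex.exp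
          ((Real.pi * I * (τ * y ^ 2) + 2 * Real.pi * I * (y * c)) +
        (Real.pi * I * (intVec n ⬝ᵥ A *ᵥ intVec n) +
          2 * Real.pi * I * (intVec n ⬝ᵥ (z₁ + (y : ℂ) • w)))) := by
        rw [hS₁.tsum_prod, tsum_swap hS₁]
    _ = ∑' (y : ℤ), κ₁ * ∑' (m : p → ℤ), Complex.exp (Real.pi * I * (τ * y ^ 2) +
      2 * Real.pi * I * (y * c) - Real.pi * I * ((z₁ + (y : ℂ) • w + intVec m) ⬝ᵥ
        A⁻¹ *ᵥ (z₁ + (y : ℂ) • w + intVec m))) := by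
        refine tsum_congr fun y => ?_
        simp only [Complex.exp_add _ (Real.pi * I * (intVec _ ⬝ᵥ A *ᵥ intVec _) + _), tsum_mul_left,
          hsum₁, sub_eq_add_neg, Complex.exp_add _ (-_)]
        ring
    _ = κ₁ * ∑' (m : p → ℤ) (y : ℤ), Complex.exp (Real.pi * I * (τ * y ^ 2) +
      2 * Real.pi * I * (y * c) - Real.pi * I * ((z₁ + (y : ℂ) • w + intVec m) ⬝ᵥ
        A⁻¹ *ᵥ (z₁ + (y : ℂ) • w + intVec m))) := by
        rw [tsum_mul_left, ← tsum_swap hS₂]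
    _ = κ₁ * ∑' (m : p → ℤ), Complex.exp
          (-(Real.pi * I * ((z₁ + intVec m) ⬝ᵥ A⁻¹ *ᵥ (z₁ + intVec m)))) *
            (κ₀ * ∑' k : ℤ, Complex.exp (-(Real.pi * I *
              (((c - w ⬝ᵥ A⁻¹ *ᵥ (z₁ + intVec m)) + k) ^ 2 / (τ - w ⬝ᵥ A⁻¹ *ᵥ w))))) := by
        congr 1
        refine tsum_congr fun m => ?_
        rw [← hsum₀, ← tsum_mul_left]
        refine tsum_congr fun y => ?_
        rw [← Complex.exp_add, ← hT₂ (m, y)]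
    _ = _ := by
        rw [hS₃.tsum_prod, mul_assoc, ← tsum_mul_left (a := κ₀)]
        congr 1
        refine tsum_congr fun m => ?_
        simp only [Complex.exp_add, tsum_mul_left]
        ring

end Border

theorem IsSiegel.hasInversion_fin : ∀ (n : ℕ) {Ω : Matrix (Fin n) (Fin n) ℂ},
    IsSiegel Ω → HasInversion Ω
  | 0, Ω, _ => by
    refine ⟨1, by simp, fun z => ?_⟩
    simp [tsum_fintype, dotProduct]
  | n + 1, Ω, h => by
    let e : Fin n ⊕ Unit ≃ Fin (n + 1) :=
      ((Equiv.refl _).sumCongr (Equiv.equivPUnit (Fin 1)).symm).trans finSumFinEquiv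
    refine HasInversion.reindex e ?_
    have h' := h.reindex e
    obtain ⟨A, w, τ, hb⟩ := exists_eq_border h'.symm
    rw [hb] at h' ⊢
    exact HasInversion.border h' (IsSiegel.hasInversion_fin n h'.of_border)

/-! ### Fifth roots of unity -/

theorem zeta_pow_five : zeta ^ 5 = 1 := by
  rw [zeta, ← Complex.exp_nat_mul]
  convert Complex.exp_two_pi_mul_I using 2
  push_cast
  ring

theorem zeta_eq : zeta = ⟨Real.cos (2 * Real.pi / 5), Real.sin (2 * Real.pi / 5)⟩ := by
  have : (2 * Real.pi * I / 5 : ℂ) = ((2 * Real.pi / 5 : ℝ) : ℂ) * I := by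
    push_cast
    ring
  rw [zeta, this]
  apply Complex.ext
  · exact Complex.exp_ofReal_mul_I_re _
  · exact Complex.exp_ofReal_mul_I_im _

theorem zeta_im_pos : 0 < zeta.im := by
  rw [zeta_eq]
  exact Real.sin_pos_of_pos_of_lt_pi (by positivity) (by linarith [Real.pi_pos])

theorem zeta_sum : 1 + zeta + zeta ^ 2 + zeta ^ 3 + zeta ^ 4 = 0 := by
  have h1 : zeta - 1 ≠ 0 := by
    intro h
    have := zeta_im_pos
    rw [sub_eq_zero.mp h] at this
    simp at this
  apply mul_left_cancel₀ h1
  linear_combination zeta_pow_five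

theorem conj_zeta : (starRingEnd ℂ) zeta = zeta ^ 4 := by
  have h1 : (starRingEnd ℂ) zeta * zeta = 1 := by
    rw [zeta, ← Complex.exp_conj, ← Complex.exp_add]
    simp only [map_div₀, map_mul, Complex.conj_ofReal, Complex.conj_I, map_ofNat]
    rw [← Complex.exp_zero]
    congr 1
    ring
  linear_combination zeta ^ 4 * h1 - (starRingEnd ℂ) zeta * zeta_pow_five

/-! ### The σ-stable subspace attached to a point of the ball -/

/-- The linear functionals on `ℂ¹²` which are eigenvectors of `σ` for the eigenvalue `l`. -/
def eigFun (l : ℂ) (X w : Fin 6 → ℂ) : Fin 3 → ℂ :=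
  ![-l ^ 3 * X 0 - l * X 3 + (1 + l ^ 2) * w 0 + w 3,
    -l ^ 3 * X 1 - l * X 4 + (1 + l ^ 2) * w 1 + w 4,
    X 2 + l * X 5 + (1 + l + l ^ 2) * w 2 - l ^ 4 * w 5]

/-- The Lagrangian subspace of `ℂ¹²` attached to the point `v` of the ball. -/
structure IsPeriodVec (v : Fin 3 → ℂ) (X w : Fin 6 → ℂ) : Prop where
  four : ∀ k, eigFun (zeta ^ 4) X w k = 0
  three_zero : (1 + zeta ^ 2) * v 2 * eigFun (zeta ^ 3) X w 0 = v 0 * eigFun (zeta ^ 3) X w 2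
  three_one : (1 + zeta ^ 2) * v 2 * eigFun (zeta ^ 3) X w 1 = v 1 * eigFun (zeta ^ 3) X w 2
  two : v 0 * eigFun (zeta ^ 2) X w 0 + v 1 * eigFun (zeta ^ 2) X w 1 =
    zeta * v 2 * eigFun (zeta ^ 2) X w 2

theorem eigFun_smul (l t : ℂ) (X w : Fin 6 → ℂ) :
    eigFun l (t • X) (t • w) = t • eigFun l X w := by
  ext k
  fin_cases k <;> simp [eigFun] <;> ring

theorem eigFun_sub (l : ℂ) (X w X' w' : Fin 6 → ℂ) :
    eigFun l (X - X') (w - w') = eigFun l X w - eigFun l X' w' := by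
  ext k
  fin_cases k <;> simp [eigFun] <;> ring

theorem IsPeriodVec.smul {v : Fin 3 → ℂ} {X w : Fin 6 → ℂ} (h : IsPeriodVec v X w) (t : ℂ) :
    IsPeriodVec v (t • X) (t • w) where
  four k := by simp [eigFun_smul, h.four]
  three_zero := by
    simp only [eigFun_smul, Pi.smul_apply, smul_eq_mul]
    linear_combination t * h.three_zero
  three_one := by
    simp only [eigFun_smul, Pi.smul_apply, smul_eq_mul]
    linear_combination t * h.three_one
  two := by
    simp only [eigFun_smul, Pi.smul_apply, smul_eq_mul]
    linear_combination t * h.two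

theorem IsPeriodVec.sub {v : Fin 3 → ℂ} {X w X' w' : Fin 6 → ℂ} (h : IsPeriodVec v X w)
    (h' : IsPeriodVec v X' w') : IsPeriodVec v (X - X') (w - w') where
  four k := by simp [eigFun_sub, h.four, h'.four]
  three_zero := by
    simp only [eigFun_sub, Pi.sub_apply]
    linear_combination h.three_zero - h'.three_zero
  three_one := by
    simp only [eigFun_sub, Pi.sub_apply]
    linear_combination h.three_one - h'.three_one
  two := by
    simp only [eigFun_sub, Pi.sub_apply]
    linear_combination h.two - h'.two

/-- With Δ cleared, these are polynomial identities modulo 1 + ζ + ζ² + ζ³ + ζ⁴, valid for every v,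
inside the ball or not. -/
theorem isPeriodVec_periodNum (v : Fin 3 → ℂ) (w : Fin 6 → ℂ) :
    IsPeriodVec v (periodNum v *ᵥ w) (periodDen v • w) := by
  have hζ := zeta_sum
  constructor
  · intro k
    fin_cases k <;>
    · simp only [eigFun, periodDen, periodNum, Matrix.mulVec, dotProduct, Fin.sum_univ_six,
        Matrix.of_apply, Matrix.cons_val, Fin.mk_one, Fin.zero_eta, Fin.reduceFinMk,
        Pi.smul_apply, smul_eq_mul]
      grind
  all_goals
    simp only [eigFun, periodDen, periodNum, Matrix.mulVec, dotProduct, Fin.sum_univ_six,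
      Matrix.of_apply, Matrix.cons_val, Pi.smul_apply, smul_eq_mul]
    grind

theorem isPeriodVec_mulVec {v : Fin 3 → ℂ} (hv : periodDen v ≠ 0) (w : Fin 6 → ℂ) :
    IsPeriodVec v (((periodDen v)⁻¹ • periodNum v) *ᵥ w) w := by
  have := (isPeriodVec_periodNum v w).smul (periodDen v)⁻¹
  rwa [smul_smul, inv_mul_cancel₀ hv, one_smul, ← Matrix.smul_mulVec] at this

/-- First half of the action of `σ` on `ℂ¹²`. -/
def sigmaFst (X w : Fin 6 → ℂ) : Fin 6 → ℂ :=
  sigma.toBlocks₁₁.map (Int.cast : ℤ → ℂ) *ᵥ X + sigma.toBlocks₁₂.map (Int.cast : ℤ → ℂ) *ᵥ w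

/-- Second half of the action of `σ` on `ℂ¹²`. -/
def sigmaSnd (X w : Fin 6 → ℂ) : Fin 6 → ℂ :=
  sigma.toBlocks₂₁.map (Int.cast : ℤ → ℂ) *ᵥ X + sigma.toBlocks₂₂.map (Int.cast : ℤ → ℂ) *ᵥ w

theorem sigmaFst_eq (X w : Fin 6 → ℂ) : sigmaFst X w =
    ![-X 0 - w 0, -X 1 - w 1, -X 5 - w 2 - w 5, -X 0 - w 0 - w 3, -X 1 - w 1 - w 4, X 2 - X 5] := by
  ext i
  fin_cases i <;> simp [sigmaFst, sigma, Matrix.mulVec, dotProduct, Fin.sum_univ_six] <;> ring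

theorem sigmaSnd_eq (X w : Fin 6 → ℂ) : sigmaSnd X w =
    ![X 0 - X 3, X 1 - X 4, X 5, X 3, X 4, w 2] := by
  ext i
  fin_cases i <;> simp [sigmaSnd, sigma, Matrix.mulVec, dotProduct, Fin.sum_univ_six] <;> ring

theorem eigFun_sigma {l : ℂ} (hl : 1 + l + l ^ 2 + l ^ 3 + l ^ 4 = 0) (X w : Fin 6 → ℂ) :
    eigFun l (sigmaFst X w) (sigmaSnd X w) = l • eigFun l X w := by
  rw [sigmaFst_eq, sigmaSnd_eq]
  ext k
  fin_cases k <;> simp [eigFun] <;> grind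

theorem sum_zeta_pow {j : ℕ} (hj : j ∈ Finset.Icc 1 4) :
    1 + zeta ^ j + (zeta ^ j) ^ 2 + (zeta ^ j) ^ 3 + (zeta ^ j) ^ 4 = 0 := by
  have h := zeta_sum
  have h5 := zeta_pow_five
  fin_cases hj <;> grind

theorem IsPeriodVec.sigma {v : Fin 3 → ℂ} {X w : Fin 6 → ℂ} (h : IsPeriodVec v X w) :
    IsPeriodVec v (sigmaFst X w) (sigmaSnd X w) where
  four k := by simp [eigFun_sigma (sum_zeta_pow (j := 4) (by simp)), h.four]
  three_zero := by
    simp only [eigFun_sigma (sum_zeta_pow (j := 3) (by simp)), Pi.smul_apply, smul_eq_mul]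
    linear_combination zeta ^ 3 * h.three_zero
  three_one := by
    simp only [eigFun_sigma (sum_zeta_pow (j := 3) (by simp)), Pi.smul_apply, smul_eq_mul]
    linear_combination zeta ^ 3 * h.three_one
  two := by
    simp only [eigFun_sigma (sum_zeta_pow (j := 2) (by simp)), Pi.smul_apply, smul_eq_mul]
    linear_combination zeta ^ 2 * h.two

/-! ### The golden ratio and positivity on the ball -/

theorem zeta_sq_add_cube : zeta ^ 2 + zeta ^ 3 = -(Real.goldenRatio : ℂ) := by
  have h1 : zeta ^ 3 = conj (zeta ^ 2) := by
    rw [map_pow, conj_zeta]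
    linear_combination (-zeta ^ 3) * zeta_pow_five
  have h2 : (zeta ^ 2).re = -(Real.goldenRatio / 2) := by
    -- The angle 4π/5 is written as π - π/5 in order to use the known value of cos(π/5).
    have h3 : zeta ^ 2 = ⟨Real.cos (Real.pi - Real.pi / 5), Real.sin (Real.pi - Real.pi / 5)⟩ := by
      have h4 : Real.pi - Real.pi / 5 = 2 * (2 * Real.pi / 5) := by ring
      rw [h4, Real.cos_two_mul, Real.sin_two_mul, zeta_eq]
      apply Complex.ext
      · simp [pow_two]
        nlinarith [Real.sin_sq_add_cos_sq (2 * Real.pi / 5)]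
      · simp [pow_two]
        ring
    rw [h3]
    simp only [Real.cos_pi_sub, Real.cos_pi_div_five, Real.goldenRatio]
    ring
  rw [h1, Complex.add_conj, h2]
  push_cast
  ring

/-- This is sin(2π/5) = φ sin(4π/5); it gives the ratio of the two weights in `five_mul_im_eq`. -/
theorem zeta_sq_im : zeta.im = Real.goldenRatio * (zeta ^ 2).im := by
  have h : (zeta : ℂ) - conj zeta = Real.goldenRatio * (zeta ^ 2 - conj (zeta ^ 2)) := by
    rw [map_pow, conj_zeta]
    have h1 := zeta_sq_add_cube
    have h5 := zeta_pow_five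
    grind
  rw [Complex.sub_conj, Complex.sub_conj] at h
  generalize Real.goldenRatio = g at *
  have h2 := congrArg Complex.im h
  simp only [Complex.im_ofReal_mul, Complex.I_im, mul_one] at h2
  linarith

theorem zeta_sq_im_pos : 0 < (zeta ^ 2).im := by
  have h1 := zeta_im_pos
  rw [zeta_sq_im] at h1
  exact pos_of_mul_pos_right h1 Real.goldenRatio_pos.le

theorem norm_sq_one_add_zeta_sq : ‖1 + zeta ^ 2‖ ^ 2 = 2 - Real.goldenRatio := by
  have h1 := zeta_sq_add_cube
  have h5 := zeta_pow_five
  apply Complex.ofReal_injective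
  generalize Real.goldenRatio = g at *
  push_cast
  rw [← Complex.mul_conj', map_add, map_pow, conj_zeta, map_one]
  grind

theorem norm_sq_one_add_zeta : ‖1 + zeta‖ ^ 2 = 1 + Real.goldenRatio := by
  have h1 := zeta_sq_add_cube
  have h5 := zeta_pow_five
  have h := zeta_sum
  apply Complex.ofReal_injective
  generalize Real.goldenRatio = g at *
  push_cast
  rw [← Complex.mul_conj', map_add, conj_zeta, map_one]
  grind

theorem norm_zeta : ‖zeta‖ = 1 := Complex.norm_eq_one_of_pow_eq_one zeta_pow_five (by norm_num)

theorem im_mul_two_I (z : ℂ) : (z.im : ℂ) * (2 * I) = z - conj z := by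
  rw [Complex.sub_conj]
  push_cast
  ring

/-- The primed variables stand for complex conjugates and ζ⁴ for the conjugate of ζ, which turns the
diagonalisation of the Hermitian form into a polynomial identity. This block serves the coordinate
pairs (0,3) and (1,4); `herm_block_two` serves (2,5). -/
theorem herm_block_one {ζ : ℂ} (h : 1 + ζ + ζ ^ 2 + ζ ^ 3 + ζ ^ 4 = 0) (a b c d a' b' c' d' : ℂ) :
    5 * (c' * a + d' * b - c * a' - d * b') =
      (ζ - ζ ^ 4) * ((-(ζ) ^ 3 * a - ζ * b + (1 + (ζ) ^ 2) * c + d) *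
        (-(ζ ^ 4) ^ 3 * a' - ζ ^ 4 * b' + (1 + (ζ ^ 4) ^ 2) * c' + d')) +
      (ζ ^ 2 - ζ ^ 3) * ((-(ζ ^ 2) ^ 3 * a - ζ ^ 2 * b + (1 + (ζ ^ 2) ^ 2) * c + d) *
        (-((ζ ^ 4) ^ 2) ^ 3 * a' - (ζ ^ 4) ^ 2 * b' + (1 + ((ζ ^ 4) ^ 2) ^ 2) * c' + d')) +
      (ζ ^ 3 - ζ ^ 2) * ((-(ζ ^ 3) ^ 3 * a - ζ ^ 3 * b + (1 + (ζ ^ 3) ^ 2) * c + d) *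
        (-((ζ ^ 4) ^ 3) ^ 3 * a' - (ζ ^ 4) ^ 3 * b' + (1 + ((ζ ^ 4) ^ 3) ^ 2) * c' + d')) +
      (ζ ^ 4 - ζ) * ((-(ζ ^ 4) ^ 3 * a - ζ ^ 4 * b + (1 + (ζ ^ 4) ^ 2) * c + d) *
        (-((ζ ^ 4) ^ 4) ^ 3 * a' - (ζ ^ 4) ^ 4 * b' + (1 + ((ζ ^ 4) ^ 4) ^ 2) * c' + d')) := by
  grind

theorem herm_block_two {ζ : ℂ} (h : 1 + ζ + ζ ^ 2 + ζ ^ 3 + ζ ^ 4 = 0) (a b c d a' b' c' d' : ℂ) :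
    5 * (c' * a + d' * b - c * a' - d * b') =
      (ζ ^ 2 - ζ ^ 3) * ((a + ζ * b + (1 + ζ + (ζ) ^ 2) * c - (ζ) ^ 4 * d) *
        (a' + ζ ^ 4 * b' + (1 + ζ ^ 4 + (ζ ^ 4) ^ 2) * c' - (ζ ^ 4) ^ 4 * d')) +
      (ζ ^ 4 - ζ) * ((a + ζ ^ 2 * b + (1 + ζ ^ 2 + (ζ ^ 2) ^ 2) * c - (ζ ^ 2) ^ 4 * d) *
        (a' + (ζ ^ 4) ^ 2 * b' + (1 + (ζ ^ 4) ^ 2 + ((ζ ^ 4) ^ 2) ^ 2) * c' - ((ζ ^ 4) ^ 2) ^ 4 * d')) +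
      (ζ - ζ ^ 4) * ((a + ζ ^ 3 * b + (1 + ζ ^ 3 + (ζ ^ 3) ^ 2) * c - (ζ ^ 3) ^ 4 * d) *
        (a' + (ζ ^ 4) ^ 3 * b' + (1 + (ζ ^ 4) ^ 3 + ((ζ ^ 4) ^ 3) ^ 2) * c' - ((ζ ^ 4) ^ 3) ^ 4 * d')) +
      (ζ ^ 3 - ζ ^ 2) * ((a + ζ ^ 4 * b + (1 + ζ ^ 4 + (ζ ^ 4) ^ 2) * c - (ζ ^ 4) ^ 4 * d) *
        (a' + (ζ ^ 4) ^ 4 * b' + (1 + (ζ ^ 4) ^ 4 + ((ζ ^ 4) ^ 4) ^ 2) * c' - ((ζ ^ 4) ^ 4) ^ 4 * d')) := by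
  grind

theorem five_mul_im_eq (X w : Fin 6 → ℂ) : 5 * (star w ⬝ᵥ X).im =
    zeta.im * (‖eigFun zeta X w 0‖ ^ 2 + ‖eigFun zeta X w 1‖ ^ 2 - ‖eigFun (zeta ^ 2) X w 2‖ ^ 2
      + ‖eigFun (zeta ^ 3) X w 2‖ ^ 2 - ‖eigFun (zeta ^ 4) X w 0‖ ^ 2
      - ‖eigFun (zeta ^ 4) X w 1‖ ^ 2)
    + (zeta ^ 2).im * (‖eigFun zeta X w 2‖ ^ 2 + ‖eigFun (zeta ^ 2) X w 0‖ ^ 2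
      + ‖eigFun (zeta ^ 2) X w 1‖ ^ 2 - ‖eigFun (zeta ^ 3) X w 0‖ ^ 2
      - ‖eigFun (zeta ^ 3) X w 1‖ ^ 2 - ‖eigFun (zeta ^ 4) X w 2‖ ^ 2) := by
  apply Complex.ofReal_injective
  apply mul_right_cancel₀ (b := 2 * I) (by simp)
  push_cast
  rw [mul_assoc, im_mul_two_I, add_mul, mul_right_comm, im_mul_two_I, mul_right_comm (_ : ℂ) _ (2 * I),
    im_mul_two_I]
  simp only [← Complex.mul_conj', eigFun, dotProduct, Fin.sum_univ_six, Pi.star_apply,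
    Complex.star_def, Matrix.cons_val, map_add, map_sub, map_neg, map_mul, map_pow, map_one,
    Complex.conj_conj, conj_zeta]
  have h := zeta_sum
  have h5 := zeta_pow_five
  have b0 := herm_block_one h (X 0) (X 3) (w 0) (w 3) (conj (X 0)) (conj (X 3)) (conj (w 0))
    (conj (w 3))
  have b1 := herm_block_one h (X 1) (X 4) (w 1) (w 4) (conj (X 1)) (conj (X 4)) (conj (w 1))
    (conj (w 4))
  have b2 := herm_block_two h (X 2) (X 5) (w 2) (w 5) (conj (X 2)) (conj (X 5)) (conj (w 2))
    (conj (w 5))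
  have e : (zeta ^ 4) ^ 2 = zeta ^ 3 := by linear_combination zeta ^ 3 * h5
  rw [e]
  rw [e] at b0 b1 b2
  linear_combination b0 + b1 + b2

/-- The coefficient (1 - √5)/2 equals -(φ - 1) = -1/φ. -/
theorem goldenRatio_mul_lt {v : Fin 3 → ℂ} (hv : hermForm v < 0) :
    Real.goldenRatio * (‖v 0‖ ^ 2 + ‖v 1‖ ^ 2) < ‖v 2‖ ^ 2 := by
  have h : hermForm v = ‖v 0‖ ^ 2 + ‖v 1‖ ^ 2 - (Real.goldenRatio - 1) * ‖v 2‖ ^ 2 := by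
    rw [hermForm, Real.goldenRatio]
    ring
  rw [h] at hv
  have h1 := Real.goldenRatio_sq
  have h2 := Real.goldenRatio_pos
  generalize Real.goldenRatio = g at *
  have h3 : g * (‖v 0‖ ^ 2 + ‖v 1‖ ^ 2 - (g - 1) * ‖v 2‖ ^ 2) < 0 := mul_neg_of_pos_of_neg h2 hv
  have h4 : (g ^ 2 - g) * ‖v 2‖ ^ 2 = ‖v 2‖ ^ 2 := by rw [h1]; ring
  linarith

theorem ne_zero_of_hermForm_neg {v : Fin 3 → ℂ} (hv : hermForm v < 0) : v 2 ≠ 0 := by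
  intro h0
  have h := goldenRatio_mul_lt hv
  rw [h0] at h
  have h2 := Real.goldenRatio_pos
  have : 0 ≤ Real.goldenRatio * (‖v 0‖ ^ 2 + ‖v 1‖ ^ 2) := by positivity
  simp at h
  linarith

/-- On the ball |η₁² + η₂²| is less than |η₃|²/φ, whereas the coefficient ζ³(1 + ζ) has modulus at
least 1. -/
theorem periodDen_ne_zero {v : Fin 3 → ℂ} (hv : hermForm v < 0) : periodDen v ≠ 0 := by
  intro h0
  have h1 : v 0 ^ 2 + v 1 ^ 2 = zeta ^ 3 * (1 + zeta) * v 2 ^ 2 := sub_eq_zero.mp h0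
  have h2 : ‖v 0 ^ 2 + v 1 ^ 2‖ ≤ ‖v 0‖ ^ 2 + ‖v 1‖ ^ 2 := by
    refine (norm_add_le _ _).trans ?_
    rw [norm_pow, norm_pow]
  rw [h1, norm_mul, norm_mul, norm_pow, norm_pow, norm_zeta, one_pow, one_mul] at h2
  have h3 : 1 ≤ ‖1 + zeta‖ := by
    have := norm_sq_one_add_zeta
    have := Real.goldenRatio_pos
    nlinarith [norm_nonneg (1 + zeta)]
  have h4 := goldenRatio_mul_lt hv
  have h5 := Real.one_lt_goldenRatio
  nlinarith [sq_nonneg ‖v 2‖, sq_nonneg ‖v 0‖, sq_nonneg ‖v 1‖]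

theorem sq_norm_add_mul_le (a b c d : ℂ) :
    ‖a * c + b * d‖ ^ 2 ≤ (‖a‖ ^ 2 + ‖b‖ ^ 2) * (‖c‖ ^ 2 + ‖d‖ ^ 2) := by
  have h : ‖a * c + b * d‖ ≤ ‖a‖ * ‖c‖ + ‖b‖ * ‖d‖ := by
    refine (norm_add_le _ _).trans ?_
    rw [norm_mul, norm_mul]
  have h2 : ‖a * c + b * d‖ ^ 2 ≤ (‖a‖ * ‖c‖ + ‖b‖ * ‖d‖) ^ 2 := by gcongr
  nlinarith [sq_nonneg (‖a‖ * ‖d‖ - ‖b‖ * ‖c‖)]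

/-- Fourier inversion on the fifth roots of unity. A combination of the values at l = ζ, …, ζ⁴ with
weights lʲ - lᵏ extracts a difference of two coefficients in l; the weights vanish at l = 1, so the
missing value there is not needed. -/
theorem eq_zero_of_eigFun_eq_zero {X w : Fin 6 → ℂ} (h1 : eigFun zeta X w = 0)
    (h2 : eigFun (zeta ^ 2) X w = 0) (h3 : eigFun (zeta ^ 3) X w = 0)
    (h4 : eigFun (zeta ^ 4) X w = 0) : X = 0 ∧ w = 0 := by
  have h := zeta_sum
  have h5 := zeta_pow_five
  have A : ∀ {a b c d : ℂ}, -zeta ^ 3 * a - zeta * b + (1 + zeta ^ 2) * c + d = 0 →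
      -(zeta ^ 2) ^ 3 * a - zeta ^ 2 * b + (1 + (zeta ^ 2) ^ 2) * c + d = 0 →
      -(zeta ^ 3) ^ 3 * a - zeta ^ 3 * b + (1 + (zeta ^ 3) ^ 2) * c + d = 0 →
      -(zeta ^ 4) ^ 3 * a - zeta ^ 4 * b + (1 + (zeta ^ 4) ^ 2) * c + d = 0 →
      (a = 0 ∧ b = 0) ∧ c = 0 ∧ d = 0 := by
    intro a b c d e1 e2 e3 e4
    have ha : -(5 * a) = 0 := by
      have : -(5 * a) = (zeta ^ 2 - zeta ^ 1) * (-zeta ^ 3 * a - zeta * b + (1 + zeta ^ 2) * c + d) +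
          ((zeta ^ 2) ^ 2 - (zeta ^ 2) ^ 1) * (-(zeta ^ 2) ^ 3 * a - (zeta ^ 2) * b + (1 + (zeta ^ 2) ^ 2) * c + d) +
          ((zeta ^ 3) ^ 2 - (zeta ^ 3) ^ 1) * (-(zeta ^ 3) ^ 3 * a - (zeta ^ 3) * b + (1 + (zeta ^ 3) ^ 2) * c + d) +
          ((zeta ^ 4) ^ 2 - (zeta ^ 4) ^ 1) * (-(zeta ^ 4) ^ 3 * a - (zeta ^ 4) * b + (1 + (zeta ^ 4) ^ 2) * c + d) := by
        clear e1 e2 e3 e4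
        grind
      rw [this, e1, e2, e3, e4]
      ring
    have hb : -(5 * b) = 0 := by
      have : -(5 * b) = (zeta ^ 4 - zeta ^ 1) * (-zeta ^ 3 * a - zeta * b + (1 + zeta ^ 2) * c + d) +
          ((zeta ^ 2) ^ 4 - (zeta ^ 2) ^ 1) * (-(zeta ^ 2) ^ 3 * a - (zeta ^ 2) * b + (1 + (zeta ^ 2) ^ 2) * c + d) +
          ((zeta ^ 3) ^ 4 - (zeta ^ 3) ^ 1) * (-(zeta ^ 3) ^ 3 * a - (zeta ^ 3) * b + (1 + (zeta ^ 3) ^ 2) * c + d) +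
          ((zeta ^ 4) ^ 4 - (zeta ^ 4) ^ 1) * (-(zeta ^ 4) ^ 3 * a - (zeta ^ 4) * b + (1 + (zeta ^ 4) ^ 2) * c + d) := by
        clear e1 e2 e3 e4
        grind
      rw [this, e1, e2, e3, e4]
      ring
    have hc : 5 * c = 0 := by
      have : 5 * c = (zeta ^ 3 - zeta ^ 1) * (-zeta ^ 3 * a - zeta * b + (1 + zeta ^ 2) * c + d) +
          ((zeta ^ 2) ^ 3 - (zeta ^ 2) ^ 1) * (-(zeta ^ 2) ^ 3 * a - (zeta ^ 2) * b + (1 + (zeta ^ 2) ^ 2) * c + d) +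
          ((zeta ^ 3) ^ 3 - (zeta ^ 3) ^ 1) * (-(zeta ^ 3) ^ 3 * a - (zeta ^ 3) * b + (1 + (zeta ^ 3) ^ 2) * c + d) +
          ((zeta ^ 4) ^ 3 - (zeta ^ 4) ^ 1) * (-(zeta ^ 4) ^ 3 * a - (zeta ^ 4) * b + (1 + (zeta ^ 4) ^ 2) * c + d) := by
        clear e1 e2 e3 e4
        grind
      rw [this, e1, e2, e3, e4]
      ring
    have hd : 5 * (c + d) = 0 := by
      have : 5 * (c + d) = (1 - zeta ^ 1) * (-zeta ^ 3 * a - zeta * b + (1 + zeta ^ 2) * c + d) +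
          (1 - (zeta ^ 2) ^ 1) * (-(zeta ^ 2) ^ 3 * a - (zeta ^ 2) * b + (1 + (zeta ^ 2) ^ 2) * c + d) +
          (1 - (zeta ^ 3) ^ 1) * (-(zeta ^ 3) ^ 3 * a - (zeta ^ 3) * b + (1 + (zeta ^ 3) ^ 2) * c + d) +
          (1 - (zeta ^ 4) ^ 1) * (-(zeta ^ 4) ^ 3 * a - (zeta ^ 4) * b + (1 + (zeta ^ 4) ^ 2) * c + d) := by
        clear e1 e2 e3 e4
        grind
      rw [this, e1, e2, e3, e4]
      ring
    have ha' : a = 0 := by linear_combination (-1 / 5 : ℂ) * ha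
    have hb' : b = 0 := by linear_combination (-1 / 5 : ℂ) * hb
    have hc' : c = 0 := by linear_combination (1 / 5 : ℂ) * hc
    have hd' : d = 0 := by linear_combination (1 / 5 : ℂ) * (hd - hc)
    exact ⟨⟨ha', hb'⟩, hc', hd'⟩
  have B : ∀ {a b c d : ℂ}, a + zeta * b + (1 + zeta + zeta ^ 2) * c - zeta ^ 4 * d = 0 →
      a + zeta ^ 2 * b + (1 + zeta ^ 2 + (zeta ^ 2) ^ 2) * c - (zeta ^ 2) ^ 4 * d = 0 →
      a + zeta ^ 3 * b + (1 + zeta ^ 3 + (zeta ^ 3) ^ 2) * c - (zeta ^ 3) ^ 4 * d = 0 →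
      a + zeta ^ 4 * b + (1 + zeta ^ 4 + (zeta ^ 4) ^ 2) * c - (zeta ^ 4) ^ 4 * d = 0 →
      (a = 0 ∧ b = 0) ∧ c = 0 ∧ d = 0 := by
    intro a b c d e1 e2 e3 e4
    have ha : 5 * (a + c) = 0 := by
      have : 5 * (a + c) = (1 - zeta ^ 2) * (a + zeta * b + (1 + zeta + zeta ^ 2) * c - zeta ^ 4 * d) +
          (1 - (zeta ^ 2) ^ 2) * (a + (zeta ^ 2) * b + (1 + (zeta ^ 2) + (zeta ^ 2) ^ 2) * c - (zeta ^ 2) ^ 4 * d) +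
          (1 - (zeta ^ 3) ^ 2) * (a + (zeta ^ 3) * b + (1 + (zeta ^ 3) + (zeta ^ 3) ^ 2) * c - (zeta ^ 3) ^ 4 * d) +
          (1 - (zeta ^ 4) ^ 2) * (a + (zeta ^ 4) * b + (1 + (zeta ^ 4) + (zeta ^ 4) ^ 2) * c - (zeta ^ 4) ^ 4 * d) := by
        clear e1 e2 e3 e4
        grind
      rw [this, e1, e2, e3, e4]
      ring
    have hb : 5 * (b + c) = 0 := by
      have : 5 * (b + c) = (zeta ^ 4 - zeta ^ 2) * (a + zeta * b + (1 + zeta + zeta ^ 2) * c - zeta ^ 4 * d) +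
          ((zeta ^ 2) ^ 4 - (zeta ^ 2) ^ 2) * (a + (zeta ^ 2) * b + (1 + (zeta ^ 2) + (zeta ^ 2) ^ 2) * c - (zeta ^ 2) ^ 4 * d) +
          ((zeta ^ 3) ^ 4 - (zeta ^ 3) ^ 2) * (a + (zeta ^ 3) * b + (1 + (zeta ^ 3) + (zeta ^ 3) ^ 2) * c - (zeta ^ 3) ^ 4 * d) +
          ((zeta ^ 4) ^ 4 - (zeta ^ 4) ^ 2) * (a + (zeta ^ 4) * b + (1 + (zeta ^ 4) + (zeta ^ 4) ^ 2) * c - (zeta ^ 4) ^ 4 * d) := by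
        clear e1 e2 e3 e4
        grind
      rw [this, e1, e2, e3, e4]
      ring
    have hc : 5 * c = 0 := by
      have : 5 * c = (zeta ^ 3 - zeta ^ 2) * (a + zeta * b + (1 + zeta + zeta ^ 2) * c - zeta ^ 4 * d) +
          ((zeta ^ 2) ^ 3 - (zeta ^ 2) ^ 2) * (a + (zeta ^ 2) * b + (1 + (zeta ^ 2) + (zeta ^ 2) ^ 2) * c - (zeta ^ 2) ^ 4 * d) +
          ((zeta ^ 3) ^ 3 - (zeta ^ 3) ^ 2) * (a + (zeta ^ 3) * b + (1 + (zeta ^ 3) + (zeta ^ 3) ^ 2) * c - (zeta ^ 3) ^ 4 * d) +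
          ((zeta ^ 4) ^ 3 - (zeta ^ 4) ^ 2) * (a + (zeta ^ 4) * b + (1 + (zeta ^ 4) + (zeta ^ 4) ^ 2) * c - (zeta ^ 4) ^ 4 * d) := by
        clear e1 e2 e3 e4
        grind
      rw [this, e1, e2, e3, e4]
      ring
    have hd : -(5 * d) = 0 := by
      have : -(5 * d) = (zeta ^ 1 - zeta ^ 2) * (a + zeta * b + (1 + zeta + zeta ^ 2) * c - zeta ^ 4 * d) +
          ((zeta ^ 2) ^ 1 - (zeta ^ 2) ^ 2) * (a + (zeta ^ 2) * b + (1 + (zeta ^ 2) + (zeta ^ 2) ^ 2) * c - (zeta ^ 2) ^ 4 * d) +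
          ((zeta ^ 3) ^ 1 - (zeta ^ 3) ^ 2) * (a + (zeta ^ 3) * b + (1 + (zeta ^ 3) + (zeta ^ 3) ^ 2) * c - (zeta ^ 3) ^ 4 * d) +
          ((zeta ^ 4) ^ 1 - (zeta ^ 4) ^ 2) * (a + (zeta ^ 4) * b + (1 + (zeta ^ 4) + (zeta ^ 4) ^ 2) * c - (zeta ^ 4) ^ 4 * d) := by
        clear e1 e2 e3 e4
        grind
      rw [this, e1, e2, e3, e4]
      ring
    have ha' : a = 0 := by linear_combination (1 / 5 : ℂ) * (ha - hc)
    have hb' : b = 0 := by linear_combination (1 / 5 : ℂ) * (hb - hc)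
    have hc' : c = 0 := by linear_combination (1 / 5 : ℂ) * hc
    have hd' : d = 0 := by linear_combination (-1 / 5 : ℂ) * hd
    exact ⟨⟨ha', hb'⟩, hc', hd'⟩
  obtain ⟨⟨a0, a3⟩, b0, b3⟩ := A (congrFun h1 0) (congrFun h2 0) (congrFun h3 0) (congrFun h4 0)
  obtain ⟨⟨a1, a4⟩, b1, b4⟩ := A (congrFun h1 1) (congrFun h2 1) (congrFun h3 1) (congrFun h4 1)
  obtain ⟨⟨a2, a5⟩, b2, b5⟩ := B (congrFun h1 2) (congrFun h2 2) (congrFun h3 2) (congrFun h4 2)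
  constructor <;> ext i <;> fin_cases i <;> assumption

/-- On the subspace the ζ-block is positive and the ζ⁴-block is absent. The indefinite ζ²- and
ζ³-blocks become positive because the plane and the line are cut out by a point of the ball. -/
theorem IsPeriodVec.eq_zero_of_im_nonpos {v : Fin 3 → ℂ} (hv : hermForm v < 0)
    {X w : Fin 6 → ℂ} (h : IsPeriodVec v X w) (him : (star w ⬝ᵥ X).im ≤ 0) : X = 0 ∧ w = 0 := by
  have key := five_mul_im_eq X w
  have hs := zeta_sq_im_pos
  have hZ := goldenRatio_mul_lt hv
  have hg1 := Real.one_lt_goldenRatio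
  have hg2 := Real.goldenRatio_sq
  have hz2 := ne_zero_of_hermForm_neg hv
  have hz2' : 0 < ‖v 2‖ ^ 2 := by positivity
  rw [zeta_sq_im, h.four, h.four, h.four, norm_zero] at key
  -- Cauchy–Schwarz applied to the equation of the plane.
  have hplane : ‖v 2‖ ^ 2 * ‖eigFun (zeta ^ 2) X w 2‖ ^ 2 ≤ (‖v 0‖ ^ 2 + ‖v 1‖ ^ 2) *
      (‖eigFun (zeta ^ 2) X w 0‖ ^ 2 + ‖eigFun (zeta ^ 2) X w 1‖ ^ 2) := by
    have h1 := sq_norm_add_mul_le (v 0) (v 1) (eigFun (zeta ^ 2) X w 0) (eigFun (zeta ^ 2) X w 1)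
    rw [h.two, norm_mul, norm_mul, norm_zeta, one_mul, mul_pow] at h1
    exact h1
  have hline0 := congrArg (fun t => ‖t‖ ^ 2) h.three_zero
  have hline1 := congrArg (fun t => ‖t‖ ^ 2) h.three_one
  simp only [norm_mul, mul_pow, norm_sq_one_add_zeta_sq] at hline0 hline1
  have e4 : eigFun (zeta ^ 4) X w = 0 := funext h.four
  have e (l : ℂ) (h0 : ‖eigFun l X w 0‖ ^ 2 = 0) (h1 : ‖eigFun l X w 1‖ ^ 2 = 0)
      (h2 : ‖eigFun l X w 2‖ ^ 2 = 0) : eigFun l X w = 0 := by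
    ext k
    fin_cases k
    · simpa using h0
    · simpa using h1
    · simpa using h2
  suffices hnorm : (‖eigFun zeta X w 0‖ ^ 2 = 0 ∧ ‖eigFun zeta X w 1‖ ^ 2 = 0 ∧
      ‖eigFun zeta X w 2‖ ^ 2 = 0) ∧ (‖eigFun (zeta ^ 2) X w 0‖ ^ 2 = 0 ∧
      ‖eigFun (zeta ^ 2) X w 1‖ ^ 2 = 0 ∧ ‖eigFun (zeta ^ 2) X w 2‖ ^ 2 = 0) ∧
      (‖eigFun (zeta ^ 3) X w 0‖ ^ 2 = 0 ∧
      ‖eigFun (zeta ^ 3) X w 1‖ ^ 2 = 0 ∧ ‖eigFun (zeta ^ 3) X w 2‖ ^ 2 = 0) from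
    eq_zero_of_eigFun_eq_zero (e _ hnorm.1.1 hnorm.1.2.1 hnorm.1.2.2)
      (e _ hnorm.2.1.1 hnorm.2.1.2.1 hnorm.2.1.2.2)
      (e _ hnorm.2.2.1 hnorm.2.2.2.1 hnorm.2.2.2.2) e4
  have p0 := sq_nonneg ‖v 0‖
  have p1 := sq_nonneg ‖v 1‖
  have q10 := sq_nonneg ‖eigFun zeta X w 0‖
  have q11 := sq_nonneg ‖eigFun zeta X w 1‖
  have q12 := sq_nonneg ‖eigFun zeta X w 2‖
  have q20 := sq_nonneg ‖eigFun (zeta ^ 2) X w 0‖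
  have q21 := sq_nonneg ‖eigFun (zeta ^ 2) X w 1‖
  have q22 := sq_nonneg ‖eigFun (zeta ^ 2) X w 2‖
  have q30 := sq_nonneg ‖eigFun (zeta ^ 3) X w 0‖
  have q31 := sq_nonneg ‖eigFun (zeta ^ 3) X w 1‖
  have q32 := sq_nonneg ‖eigFun (zeta ^ 3) X w 2‖
  generalize Real.goldenRatio = g at *
  generalize ‖v 0‖ ^ 2 = x at *
  generalize ‖v 1‖ ^ 2 = y at *
  generalize ‖v 2‖ ^ 2 = z at *
  generalize ‖eigFun zeta X w 0‖ ^ 2 = a0 at *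
  generalize ‖eigFun zeta X w 1‖ ^ 2 = a1 at *
  generalize ‖eigFun zeta X w 2‖ ^ 2 = a2 at *
  generalize ‖eigFun (zeta ^ 2) X w 0‖ ^ 2 = b0 at *
  generalize ‖eigFun (zeta ^ 2) X w 1‖ ^ 2 = b1 at *
  generalize ‖eigFun (zeta ^ 2) X w 2‖ ^ 2 = b2 at *
  generalize ‖eigFun (zeta ^ 3) X w 0‖ ^ 2 = c0 at *
  generalize ‖eigFun (zeta ^ 3) X w 1‖ ^ 2 = c1 at *
  generalize ‖eigFun (zeta ^ 3) X w 2‖ ^ 2 = c2 at *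
  have hg0 : 0 < g := by linarith
  have tot : g * (a0 + a1) + a2 + (b0 + b1 - g * b2) + (g * c2 - (c0 + c1)) ≤ 0 := by
    have h1 : (zeta ^ 2).im * (g * (a0 + a1) + a2 + (b0 + b1 - g * b2) + (g * c2 - (c0 + c1)))
        ≤ 0 := by nlinarith
    exact nonpos_of_mul_nonpos_right h1 hs
  have hB : 0 ≤ z * (b0 + b1 - g * b2) - (z - g * (x + y)) * (b0 + b1) := by
    nlinarith [mul_le_mul_of_nonneg_left hplane hg0.le]
  -- The factor 2 - g is |1 + ζ²|², and it equals 1/g².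
  have hC' : z * (c0 + c1) = g ^ 2 * (x + y) * c2 := by
    have hl : (2 - g) * z * (c0 + c1) = (x + y) * c2 := by linarith
    have h1 : g ^ 2 * (2 - g) = 1 := by linear_combination (1 - g) * hg2
    calc z * (c0 + c1) = g ^ 2 * (2 - g) * z * (c0 + c1) := by rw [h1, one_mul]
      _ = g ^ 2 * ((2 - g) * z * (c0 + c1)) := by ring
      _ = _ := by rw [hl]; ring
  have hC : z * (g * c2 - (c0 + c1)) = (z - g * (x + y)) * (g * c2) := by
    linear_combination -hC'
  have hd : 0 < z - g * (x + y) := by linarith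
  have B0 : 0 ≤ b0 + b1 - g * b2 := by
    refine nonneg_of_mul_nonneg_right (a := z) ?_ hz2'
    have : 0 ≤ (z - g * (x + y)) * (b0 + b1) := by positivity
    linarith
  have C0 : 0 ≤ g * c2 - (c0 + c1) := by
    refine nonneg_of_mul_nonneg_right (a := z) ?_ hz2'
    rw [hC]
    positivity
  have A0 : 0 ≤ g * (a0 + a1) := by positivity
  -- Nonnegative blocks with nonpositive sum all vanish.
  have hA0 : g * (a0 + a1) = 0 := by linarith
  have hA1 : a0 + a1 = 0 := (mul_eq_zero.mp hA0).resolve_left hg0.ne'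
  have hB1 : b0 + b1 - g * b2 = 0 := by linarith
  have hC1 : g * c2 - (c0 + c1) = 0 := by linarith
  rw [hB1] at hB
  have hb : b0 + b1 ≤ 0 := by
    refine nonpos_of_mul_nonpos_right (a := z - g * (x + y)) ?_ hd
    linarith
  rw [hC1, mul_zero] at hC
  have hc : c2 = 0 := by
    rcases mul_eq_zero.mp hC.symm with h0 | h0
    · exact absurd h0 hd.ne'
    · exact (mul_eq_zero.mp h0).resolve_left hg0.ne'
  have hb2 : g * b2 = 0 := by
    have : 0 ≤ g * b2 := by positivity
    linarith
  refine ⟨⟨by linarith, by linarith, by linarith⟩, ⟨by linarith, by linarith,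
    (mul_eq_zero.mp hb2).resolve_left hg0.ne'⟩, ?_, ?_, hc⟩
  · rw [hc] at hC1
    linarith
  · rw [hc] at hC1
    linarith

/-- The period matrix in terms of homogeneous coordinates. -/
noncomputable def periodMat (v : Fin 3 → ℂ) : Matrix (Fin 6) (Fin 6) ℂ := (periodDen v)⁻¹ • periodNum v

theorem isPeriodVec_periodMat {v : Fin 3 → ℂ} (hv : hermForm v < 0)
    (w : Fin 6 → ℂ) : IsPeriodVec v (periodMat v *ᵥ w) w :=
  isPeriodVec_mulVec (periodDen_ne_zero hv) w

/-- Subtracting the point of the graph over the same w leaves a vector whose second half is zero.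
The form vanishes on it, so definiteness kills it. -/
theorem IsPeriodVec.eq_mulVec {v : Fin 3 → ℂ} (hv : hermForm v < 0) {X w : Fin 6 → ℂ}
    (h : IsPeriodVec v X w) :
    X = periodMat v *ᵥ w := by
  have h1 := h.sub (isPeriodVec_periodMat hv w)
  rw [sub_self] at h1
  exact sub_eq_zero.mp (h1.eq_zero_of_im_nonpos hv (by simp)).1

theorem isSiegel_periodMat {v : Fin 3 → ℂ} (hv : hermForm v < 0) : IsSiegel (periodMat v) where
  symm := by
    rw [periodMat, Matrix.transpose_smul]
    congr 1
    ext i j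
    fin_cases i <;> fin_cases j <;> rfl
  pos u hu := by
    by_contra! h
    exact hu ((isPeriodVec_periodMat hv u).eq_zero_of_im_nonpos hv h).2

/-- The fixed point equation AΩ + B = Ω(CΩ + D), applied to w. -/
theorem sigmaFst_periodMat {v : Fin 3 → ℂ} (hv : hermForm v < 0) (w : Fin 6 → ℂ) :
    sigmaFst (periodMat v *ᵥ w) w = periodMat v *ᵥ sigmaSnd (periodMat v *ᵥ w) w :=
  (isPeriodVec_periodMat hv w).sigma.eq_mulVec hv

/-! ### Eigenvectors of σ and the determinant of its automorphy factor -/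

/-- Eigenvectors of `σ` for the eigenvalue `l`: first half. -/
def eigFst (l : ℂ) (t : Fin 3 → ℂ) : Fin 6 → ℂ :=
  ![t 0, t 1, -(l ^ 2 + l ^ 3) * t 2, (1 + l + l ^ 2) * t 0, (1 + l + l ^ 2) * t 1, -l ^ 2 * t 2]

/-- Eigenvectors of `σ` for the eigenvalue `l`: second half. -/
def eigSnd (l : ℂ) (t : Fin 3 → ℂ) : Fin 6 → ℂ :=
  ![-(1 + l) * t 0, -(1 + l) * t 1, -l * t 2, (1 + l + l ^ 4) * t 0, (1 + l + l ^ 4) * t 1, -t 2]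

theorem sigmaSnd_eig {l : ℂ} (hl : 1 + l + l ^ 2 + l ^ 3 + l ^ 4 = 0) (t : Fin 3 → ℂ) :
    sigmaSnd (eigFst l t) (eigSnd l t) = l • eigSnd l t := by
  rw [sigmaSnd_eq]
  ext k
  fin_cases k <;> simp [eigFst, eigSnd] <;> grind

theorem isPeriodVec_eig_one (v t : Fin 3 → ℂ) :
    IsPeriodVec v (eigFst zeta t) (eigSnd zeta t) := by
  have h := zeta_sum
  constructor
  · intro k
    fin_cases k <;> simp [eigFst, eigSnd, eigFun] <;> grind
  all_goals simp [eigFst, eigSnd, eigFun]; grind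

theorem isPeriodVec_eig_three (v : Fin 3 → ℂ) :
    IsPeriodVec v (eigFst (zeta ^ 3) ![v 0, v 1, (1 + zeta ^ 2) * v 2])
      (eigSnd (zeta ^ 3) ![v 0, v 1, (1 + zeta ^ 2) * v 2]) := by
  have h := zeta_sum
  constructor
  · intro k
    fin_cases k <;> simp [eigFst, eigSnd, eigFun] <;> grind
  all_goals simp [eigFst, eigSnd, eigFun]; grind

theorem isPeriodVec_eig_two (v t : Fin 3 → ℂ) (ht : v 0 * t 0 + v 1 * t 1 = zeta * v 2 * t 2) :
    IsPeriodVec v (eigFst (zeta ^ 2) t) (eigSnd (zeta ^ 2) t) := by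
  have h := zeta_sum
  constructor
  · intro k
    fin_cases k <;> simp [eigFst, eigSnd, eigFun] <;> grind
  all_goals simp [eigFst, eigSnd, eigFun]; grind

/-- The columns are eigenvectors of the automorphy factor of `σ`. -/
noncomputable def eigMat (v : Fin 3 → ℂ) : Matrix (Fin 6) (Fin 6) ℂ :=
  (Matrix.of ![eigSnd zeta ![1, 0, 0], eigSnd zeta ![0, 1, 0], eigSnd zeta ![0, 0, 1],
    eigSnd (zeta ^ 3) ![v 0, v 1, (1 + zeta ^ 2) * v 2],
    eigSnd (zeta ^ 2) ![zeta * v 2, 0, v 0], eigSnd (zeta ^ 2) ![0, zeta * v 2, v 1]])ᵀ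

theorem eigMat_det (v : Fin 3 → ℂ) :
    (zeta - zeta ^ 3) * (eigMat v).det = 5 * v 2 * periodDen v := by
  rw [eigMat, Matrix.det_transpose, periodDen]
  simp [Matrix.det_succ_row_zero, Fin.sum_univ_succ, eigSnd, Fin.succAbove]
  have h := zeta_sum
  grind

theorem eigMat_det_ne_zero {v : Fin 3 → ℂ} (hv : hermForm v < 0) : (eigMat v).det ≠ 0 := by
  intro h0
  have h := eigMat_det v
  rw [h0, mul_zero] at h
  exact mul_ne_zero (mul_ne_zero (by norm_num) (ne_zero_of_hermForm_neg hv))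
    (periodDen_ne_zero hv) h.symm

/-- The automorphy factor `CΩ + D` of `σ`. -/
noncomputable def automorphy (Ω : Matrix (Fin 6) (Fin 6) ℂ) : Matrix (Fin 6) (Fin 6) ℂ :=
  sigma.toBlocks₂₁.map (Int.cast : ℤ → ℂ) * Ω + sigma.toBlocks₂₂.map (Int.cast : ℤ → ℂ)

theorem automorphy_mulVec (Ω : Matrix (Fin 6) (Fin 6) ℂ) (w : Fin 6 → ℂ) :
    automorphy Ω *ᵥ w = sigmaSnd (Ω *ᵥ w) w := by
  rw [automorphy, sigmaSnd, Matrix.add_mulVec, Matrix.mulVec_mulVec]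

theorem automorphy_mulVec_eig {v : Fin 3 → ℂ} (hv : hermForm v < 0) {l : ℂ}
    (hl : 1 + l + l ^ 2 + l ^ 3 + l ^ 4 = 0) {t : Fin 3 → ℂ}
    (h : IsPeriodVec v (eigFst l t) (eigSnd l t)) :
    automorphy (periodMat v) *ᵥ eigSnd l t = l • eigSnd l t := by
  rw [automorphy_mulVec, ← h.eq_mulVec hv, sigmaSnd_eig hl]

/-- The projection of the graph to its second half carries σ to CΩ + D, so an eigenbasis of the
graph diagonalises it; the product of the eigenvalues is ζ¹⁰. -/
theorem automorphy_det {v : Fin 3 → ℂ} (hv : hermForm v < 0) :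
    (automorphy (periodMat v)).det = 1 := by
  have key : automorphy (periodMat v) * eigMat v =
      eigMat v * Matrix.diagonal ![zeta, zeta, zeta, zeta ^ 3, zeta ^ 2, zeta ^ 2] := by
    have h1 (t) := automorphy_mulVec_eig hv zeta_sum (isPeriodVec_eig_one v t)
    have h3 := automorphy_mulVec_eig hv (sum_zeta_pow (j := 3) (by simp)) (isPeriodVec_eig_three v)
    have h2 (t) (ht) :=
      automorphy_mulVec_eig hv (sum_zeta_pow (j := 2) (by simp)) (isPeriodVec_eig_two v t ht)
    ext i j
    rw [Matrix.mul_diagonal, mul_comm (eigMat v i j)]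
    fin_cases j
    · exact congrFun (h1 ![1, 0, 0]) i
    · exact congrFun (h1 ![0, 1, 0]) i
    · exact congrFun (h1 ![0, 0, 1]) i
    · exact congrFun h3 i
    · exact congrFun (h2 ![zeta * v 2, 0, v 0] (by simp; ring)) i
    · exact congrFun (h2 ![0, zeta * v 2, v 1] (by simp; ring)) i
  have hdet := congrArg Matrix.det key
  rw [Matrix.det_mul, Matrix.det_mul, Matrix.det_diagonal, mul_comm] at hdet
  rw [mul_left_cancel₀ (eigMat_det_ne_zero hv) hdet]
  simp only [Fin.prod_univ_six, Matrix.cons_val]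
  linear_combination (zeta ^ 5 + 1) * zeta_pow_five

/-- The coordinates of the theta series in which the Poisson summation takes place. -/
def pivot : Fin 5 → Fin 6 := ![0, 1, 3, 4, 5]

theorem pivot_injective : Function.Injective pivot := by decide

theorem succAbove_two_eq_pivot (j : Fin 5) : Fin.succAbove 2 j = pivot j := by
  decide +revert

theorem automorphy_apply (Ω : Matrix (Fin 6) (Fin 6) ℂ) (i j : Fin 6) : automorphy Ω i j =
    ![Ω 0 j - Ω 3 j, Ω 1 j - Ω 4 j, Ω 5 j, Ω 3 j, Ω 4 j, if j = 2 then 1 else 0] i := by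
  have h : automorphy Ω i j = (automorphy Ω *ᵥ Pi.single j 1) i := by simp
  rw [h, automorphy_mulVec, sigmaSnd_eq]
  simp [Pi.single_apply, eq_comm]

/-- The last row of CΩ + D is a unit vector supported at column 2. Expanding along it leaves the
pivot block times an integral matrix of determinant 1, with sign (-1)^(5+2). -/
theorem det_automorphy_eq (Ω : Matrix (Fin 6) (Fin 6) ℂ) :
    (automorphy Ω).det = -(Ω.submatrix pivot pivot).det := by
  have hN : ∀ j, (automorphy Ω) 5 j = if j = 2 then 1 else 0 := fun j => by
    rw [automorphy_apply]
    rfl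
  have hU : (automorphy Ω).submatrix (Fin.succAbove 5) (Fin.succAbove 2) =
      !![1, 0, -1, 0, 0; 0, 1, 0, -1, 0; 0, 0, 0, 0, 1; 0, 0, 1, 0, 0; 0, 0, 0, 1, 0] *
        Ω.submatrix pivot pivot := by
    ext i j
    rw [Matrix.submatrix_apply, automorphy_apply, succAbove_two_eq_pivot, Matrix.mul_apply,
      Fin.sum_univ_five]
    simp only [Matrix.submatrix_apply]
    generalize pivot j = k
    fin_cases i <;> simp [pivot, Fin.succAbove, sub_eq_add_neg]
  have hdet : (!![1, 0, -1, 0, 0; 0, 1, 0, -1, 0; 0, 0, 0, 0, 1; 0, 0, 1, 0, 0; 0, 0, 0, 1, 0] :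
      Matrix (Fin 5) (Fin 5) ℂ).det = 1 := by
    simp [Matrix.det_succ_row_zero, Fin.sum_univ_succ, Fin.succAbove]
  rw [Matrix.det_succ_row _ 5, Finset.sum_eq_single 2]
  · rw [hN, if_pos rfl, hU, Matrix.det_mul, hdet]
    norm_num
  · intro j _ hj
    rw [hN, if_neg hj]
    ring
  · simp

theorem det_pivot {v : Fin 3 → ℂ} (hv : hermForm v < 0) :
    ((periodMat v).submatrix pivot pivot).det = -1 := by
  rw [← automorphy_det hv, det_automorphy_eq, neg_neg]

/-! ### Partial inversion of the theta series -/

/-- The characteristic a is absorbed by completing the square: the inversion formula is used at w +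
Aa. -/
theorem IsSiegel.inversion_char {k : ℕ} {A : Matrix (Fin k) (Fin k) ℂ} (hA : IsSiegel A) :
    ∃ κ : ℂ, κ ^ 2 * A.det = I ^ k ∧ ∀ a w : Fin k → ℂ,
    ∑' n : Fin k → ℤ, Complex.exp (Real.pi * I * ((intVec n + a) ⬝ᵥ A *ᵥ (intVec n + a))
      + 2 * Real.pi * I * ((intVec n + a) ⬝ᵥ w)) =
    κ * ∑' m : Fin k → ℤ, Complex.exp
      (-(Real.pi * I * ((w + intVec m) ⬝ᵥ A⁻¹ *ᵥ (w + intVec m)))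
        - 2 * Real.pi * I * (a ⬝ᵥ intVec m)) := by
  obtain ⟨κ, hκ, h⟩ := IsSiegel.hasInversion_fin k hA
  refine ⟨κ, by simpa using hκ, fun a w => ?_⟩
  have key := congrArg
    (fun t => Complex.exp (Real.pi * I * (a ⬝ᵥ A *ᵥ a) + 2 * Real.pi * I * (a ⬝ᵥ w)) * t)
    (h (w + A *ᵥ a))
  simp only [mul_left_comm _ κ] at key
  rw [← tsum_mul_left, ← tsum_mul_left] at key
  simp only [← Complex.exp_add] at key
  refine Eq.trans (tsum_congr fun n => ?_) (key.trans ?_)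
  · congr 1
    simp only [Matrix.mulVec_add, dotProduct_add, add_dotProduct]
    rw [dotProduct_mulVec_comm_of_symm hA.symm a (intVec n)]
    ring
  · congr 1
    refine tsum_congr fun m => ?_
    congr 1
    have h1 : w + A *ᵥ a + intVec m = (w + intVec m) + A *ᵥ a := by abel
    rw [h1]
    have h2 : a ⬝ᵥ intVec m = a ⬝ᵥ (w + intVec m) - a ⬝ᵥ w := by
      rw [dotProduct_add]
      ring
    rw [h2]
    generalize w + intVec m = u
    have h3 : (A *ᵥ a) ⬝ᵥ A⁻¹ *ᵥ u = a ⬝ᵥ u := by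
      rw [dotProduct_mulVec_comm_of_symm hA.inv_symm, hA.inv_mulVec, dotProduct_comm]
    have h4 : u ⬝ᵥ a = a ⬝ᵥ u := dotProduct_comm _ _
    simp only [Matrix.mulVec_add, dotProduct_add, add_dotProduct, hA.inv_mulVec, h3, h4]
    rw [dotProduct_comm (A *ᵥ a) a]
    ring

/-- The underlying complex vector of a real vector. -/
def realVec {ι : Type*} (a : ι → ℝ) : ι → ℂ := fun i => a i

theorem thetaTerm_eq {g : ℕ} (a b : Fin g → ℝ) (Ω : Matrix (Fin g) (Fin g) ℂ) (n : Fin g → ℤ) :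
    thetaTerm a b 0 Ω n = Complex.exp
      (Real.pi * I * ((intVec n + realVec a) ⬝ᵥ Ω *ᵥ (intVec n + realVec a))
        + 2 * Real.pi * I * ((intVec n + realVec a) ⬝ᵥ realVec b)) := by
  simp only [thetaTerm, Pi.zero_apply, zero_add]
  rfl

theorem IsSiegel.summable_thetaTerm {g : ℕ} {Ω : Matrix (Fin g) (Fin g) ℂ} (h : IsSiegel Ω)
    (a b : Fin g → ℝ) : Summable (thetaTerm a b 0 Ω) :=
  (h.summable_add (realVec a) (realVec b)).congr fun n => (thetaTerm_eq a b Ω n).symm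

theorem dotProduct_pivot (u w : Fin 6 → ℂ) :
    u ⬝ᵥ w = u 2 * w 2 + (u ∘ pivot) ⬝ᵥ (w ∘ pivot) := by
  simp only [dotProduct]
  rw [Fin.sum_univ_succAbove _ 2]
  simp only [succAbove_two_eq_pivot, Function.comp_apply]

theorem mulVec_pivot (Ω : Matrix (Fin 6) (Fin 6) ℂ) (u : Fin 6 → ℂ) :
    (Ω *ᵥ u) ∘ pivot =
      u 2 • (fun i => Ω (pivot i) 2) + Ω.submatrix pivot pivot *ᵥ (u ∘ pivot) := by
  ext i
  have := dotProduct_pivot (Ω (pivot i)) u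
  rw [mul_comm] at this
  exact this

theorem mulVec_two {Ω : Matrix (Fin 6) (Fin 6) ℂ} (h : Ωᵀ = Ω) (u : Fin 6 → ℂ) :
    (Ω *ᵥ u) 2 = Ω 2 2 * u 2 + (fun i => Ω (pivot i) 2) ⬝ᵥ (u ∘ pivot) := by
  have := dotProduct_pivot (Ω 2) u
  have h2 : (Ω 2) ∘ pivot = fun i => Ω (pivot i) 2 := funext fun i => congrFun (congrFun h _) _
  rw [h2] at this
  exact this

/-- Splitting off the coordinate which is not inverted. -/
def pivotEquiv : ℤ × (Fin 5 → ℤ) ≃ (Fin 6 → ℤ) := Fin.insertNthEquiv (fun _ => ℤ) 2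

theorem intVec_pivotEquiv_two (x : ℤ × (Fin 5 → ℤ)) : intVec (pivotEquiv x) 2 = x.1 := by
  simp [intVec, pivotEquiv]

theorem intVec_pivotEquiv_pivot (x : ℤ × (Fin 5 → ℤ)) :
    intVec (pivotEquiv x) ∘ pivot = intVec x.2 := by
  ext i
  simp only [Function.comp_apply, ← succAbove_two_eq_pivot]
  simp [intVec, pivotEquiv]

/-- The lattice points in terms of the dual variables of the inversion. -/
def dualEquiv : ℤ × (Fin 5 → ℤ) ≃ (Fin 6 → ℤ) where
  toFun x := ![-x.2 0 + x.2 2, -x.2 1 + x.2 3, -x.2 4, -x.2 2, -x.2 3, x.1]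
  invFun n := (n 5, ![-n 0 - n 3, -n 1 - n 4, -n 3, -n 4, -n 2])
  left_inv x := by
    refine Prod.ext rfl (funext fun i => ?_)
    fin_cases i <;> simp
  right_inv n := by
    ext i
    fin_cases i <;> simp

theorem summand_split {Ω : Matrix (Fin 6) (Fin 6) ℂ} (hΩ : Ωᵀ = Ω) (a b : Fin 6 → ℝ)
    (x : ℤ × (Fin 5 → ℤ)) :
    thetaTerm a b 0 Ω (pivotEquiv x) =
      Complex.exp (Real.pi * I * (Ω 2 2 * (x.1 + a 2) ^ 2) + 2 * Real.pi * I * ((x.1 + a 2) * b 2)) *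
      Complex.exp (Real.pi * I * ((intVec x.2 + realVec a ∘ pivot) ⬝ᵥ
        Ω.submatrix pivot pivot *ᵥ (intVec x.2 + realVec a ∘ pivot)) +
        2 * Real.pi * I * ((intVec x.2 + realVec a ∘ pivot) ⬝ᵥ
          (realVec b ∘ pivot + ((x.1 : ℂ) + a 2) • fun i => Ω (pivot i) 2))) := by
  rw [thetaTerm_eq, ← Complex.exp_add]
  congr 1
  have h2 : (intVec (pivotEquiv x) + realVec a) 2 = x.1 + a 2 := by
    rw [Pi.add_apply, intVec_pivotEquiv_two]
    rfl
  have hp : (intVec (pivotEquiv x) + realVec a) ∘ pivot = intVec x.2 + realVec a ∘ pivot := by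
    rw [← intVec_pivotEquiv_pivot]
    rfl
  rw [dotProduct_pivot _ (Ω *ᵥ _), dotProduct_pivot _ (realVec b), mulVec_pivot, mulVec_two hΩ, h2,
    hp]
  generalize intVec x.2 + realVec a ∘ pivot = u
  simp only [dotProduct_add, dotProduct_smul, smul_eq_mul, realVec]
  rw [dotProduct_comm (fun i => Ω (pivot i) 2) u]
  ring

/-- This is where σ fixing Ω enters: up to an elementary quadratic polynomial in c and t, the
exponent of the partially inverted series is again the form Ω, evaluated at the image of a vector
under CΩ + D. -/
theorem dual_exponent {v : Fin 3 → ℂ} (hv : hermForm v < 0) (t : ℂ) (c : Fin 5 → ℂ) :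
    t ^ 2 * periodMat v 2 2 - (c + t • fun i => periodMat v (pivot i) 2) ⬝ᵥ
        ((periodMat v).submatrix pivot pivot)⁻¹ *ᵥ (c + t • fun i => periodMat v (pivot i) 2) =
      ![-c 0 + c 2, -c 1 + c 3, -c 4, -c 2, -c 3, t] ⬝ᵥ
        periodMat v *ᵥ ![-c 0 + c 2, -c 1 + c 3, -c 4, -c 2, -c 3, t] +
      (c 0 ^ 2 + c 1 ^ 2 + c 4 ^ 2 - 2 * c 4 * t) := by
  have hΩ := isSiegel_periodMat hv
  have hA := hΩ.submatrix pivot_injective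
  set Ω := periodMat v with hΩdef
  set u := (Ω.submatrix pivot pivot)⁻¹ *ᵥ (c + t • fun i => Ω (pivot i) 2) with hu
  have hAu : Ω.submatrix pivot pivot *ᵥ u = c + t • fun i => Ω (pivot i) 2 := hA.mulVec_inv _
  -- W is chosen so that the pivot coordinates of ΩW are -c; its image under CΩ + D is then the
  -- vector on the right-hand side.
  set W : Fin 6 → ℂ := ![-u 0, -u 1, t, -u 2, -u 3, -u 4] with hW
  have hWp : W ∘ pivot = -u := by
    ext i
    fin_cases i <;> rfl
  have hXp : (Ω *ᵥ W) ∘ pivot = -c := by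
    rw [mulVec_pivot, hWp, Matrix.mulVec_neg, hAu]
    ext i
    simp [hW]
  have hX2 := mulVec_two hΩ.symm W
  have hS := sigmaFst_periodMat hv W
  rw [← hΩdef, sigmaSnd_eq, sigmaFst_eq] at hS
  have e0 : (Ω *ᵥ W) 0 = -c 0 := congrFun hXp 0
  have e1 : (Ω *ᵥ W) 1 = -c 1 := congrFun hXp 1
  have e3 : (Ω *ᵥ W) 3 = -c 2 := congrFun hXp 2
  have e4 : (Ω *ᵥ W) 4 = -c 3 := congrFun hXp 3
  have e5 : (Ω *ᵥ W) 5 = -c 4 := congrFun hXp 4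
  have hw : ![-c 0 + c 2, -c 1 + c 3, -c 4, -c 2, -c 3, t] =
      ![(Ω *ᵥ W) 0 - (Ω *ᵥ W) 3, (Ω *ᵥ W) 1 - (Ω *ᵥ W) 4, (Ω *ᵥ W) 5, (Ω *ᵥ W) 3, (Ω *ᵥ W) 4,
        W 2] := by
    rw [e0, e1, e3, e4, e5]
    ext i
    fin_cases i <;> simp [hW]
  -- The fixed point equation replaces Ω(CΩ + D)W by (AΩ + B)W, which is explicit in c, t and u.
  rw [hw, ← hS, ← hw, e0, e1, e5, hX2, hWp, add_dotProduct, smul_dotProduct, dotProduct_neg]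
  generalize (fun i => Ω (pivot i) 2) ⬝ᵥ u = r
  simp [dotProduct, Fin.sum_univ_succ, hW]
  ring

theorem exists_mul_sub_eq_two_mul {a : ℤ} (ha : Odd a) (m : ℤ) : ∃ k : ℤ, m * (m - a) = 2 * k := by
  obtain ⟨j, rfl⟩ := ha
  rcases Int.even_or_odd' m with ⟨i, rfl | rfl⟩
  · exact ⟨i * (2 * i - (2 * j + 1)), by ring⟩
  · exact ⟨(2 * i + 1) * (i - j), by ring⟩

theorem dual_summand {v : Fin 3 → ℂ} (hv : hermForm v < 0) {a : Fin 3 → ℤ} (ha : ∀ i, Odd (a i))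
    (x : ℤ × (Fin 5 → ℤ)) :
    Complex.exp (Real.pi * I * (periodMat v 2 2 * (x.1 + charA a 2) ^ 2) +
        2 * Real.pi * I * ((x.1 + charA a 2) * charB a 2)) *
      Complex.exp (-(Real.pi * I * ((realVec (charB a) ∘ pivot +
          ((x.1 : ℂ) + charA a 2) • (fun i => periodMat v (pivot i) 2) + intVec x.2) ⬝ᵥ
        ((periodMat v).submatrix pivot pivot)⁻¹ *ᵥ (realVec (charB a) ∘ pivot +
          ((x.1 : ℂ) + charA a 2) • (fun i => periodMat v (pivot i) 2) + intVec x.2)))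
        - 2 * Real.pi * I * ((realVec (charA a) ∘ pivot) ⬝ᵥ intVec x.2)) =
    Complex.exp (Real.pi * I * ((2 * a 0 ^ 2 + 2 * a 1 ^ 2 + a 2 ^ 2) / 20)) *
      thetaTerm (charA a) (charB a) 0 (periodMat v) (dualEquiv x) := by
  obtain ⟨y, m⟩ := x
  obtain ⟨k₀, h₀⟩ := exists_mul_sub_eq_two_mul (ha 0) (m 0)
  obtain ⟨k₁, h₁⟩ := exists_mul_sub_eq_two_mul (ha 1) (m 1)
  obtain ⟨k₂, h₂⟩ := exists_mul_sub_eq_two_mul (ha 2) (m 4)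
  replace h₀ : (m 0 : ℂ) * (m 0 - a 0) = 2 * k₀ := by exact_mod_cast h₀
  replace h₁ : (m 1 : ℂ) * (m 1 - a 1) = 2 * k₁ := by exact_mod_cast h₁
  replace h₂ : (m 4 : ℂ) * (m 4 - a 2) = 2 * k₂ := by exact_mod_cast h₂
  set t : ℂ := (y : ℂ) + charA a 2 with ht
  set c : Fin 5 → ℂ := realVec (charB a) ∘ pivot + intVec m with hc
  have key := dual_exponent hv t c
  have hw : ![-c 0 + c 2, -c 1 + c 3, -c 4, -c 2, -c 3, t] =
      intVec (dualEquiv (y, m)) + realVec (charA a) := by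
    ext i
    fin_cases i <;> simp [hc, ht, intVec, realVec, dualEquiv, charA, charB, pivot] <;> ring
  have hr : realVec (charB a) ∘ pivot + t • (fun i => periodMat v (pivot i) 2) + intVec m =
      c + t • fun i => periodMat v (pivot i) 2 := by
    rw [hc]
    abel
  rw [hw] at key
  rw [hr, thetaTerm_eq, ← Complex.exp_add, ← Complex.exp_add, Complex.exp_eq_exp_iff_exists_int]
  -- The leftover terms are m(m - a) in three coordinates, even because a is odd, and the cross term
  -- -2 m₄ y.
  refine ⟨k₀ + k₁ + k₂ - m 4 * y, ?_⟩
  have hfin : (c 0 ^ 2 + c 1 ^ 2 + c 4 ^ 2 - 2 * c 4 * t) + 2 * (t * charB a 2) -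
      2 * ((realVec (charA a) ∘ pivot) ⬝ᵥ intVec m) =
      (2 * a 0 ^ 2 + 2 * a 1 ^ 2 + a 2 ^ 2) / 20 +
        2 * ((intVec (dualEquiv (y, m)) + realVec (charA a)) ⬝ᵥ realVec (charB a)) +
        2 * (k₀ + k₁ + k₂ - m 4 * y) := by
    simp [hc, ht, intVec, realVec, dualEquiv, charA, charB, pivot, dotProduct, Fin.sum_univ_succ]
    linear_combination h₀ + h₁ + h₂
  push_cast
  linear_combination (Real.pi * I) * (key + hfin)

/-- The value of κ² comes from the pivot block having determinant -1 together with I⁵ = I. -/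
theorem thetaConst_functional_equation {v : Fin 3 → ℂ} (hv : hermForm v < 0) {a : Fin 3 → ℤ}
    (ha : ∀ i, Odd (a i)) : ∃ κ : ℂ, κ ^ 2 = -I ∧
      thetaConst (charA a) (charB a) (periodMat v) =
        κ * Complex.exp (Real.pi * I * ((2 * a 0 ^ 2 + 2 * a 1 ^ 2 + a 2 ^ 2) / 20)) *
          thetaConst (charA a) (charB a) (periodMat v) := by
  have hΩ := isSiegel_periodMat hv
  obtain ⟨κ, hκ, hsum⟩ := (hΩ.submatrix pivot_injective).inversion_char
  refine ⟨κ, ?_, ?_⟩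
  · rw [det_pivot hv] at hκ
    have h4 := Complex.I_pow_four
    linear_combination -hκ - I * h4
  have hS := hΩ.summable_thetaTerm (charA a) (charB a)
  have hS₁ := (pivotEquiv.summable_iff (f := thetaTerm (charA a) (charB a) 0 (periodMat v))).mpr hS
  have hS₂ := (dualEquiv.summable_iff (f := thetaTerm (charA a) (charB a) 0 (periodMat v))).mpr hS
  rw [thetaConst, theta]
  conv_lhs => rw [← pivotEquiv.tsum_eq]
  conv_rhs => rw [← dualEquiv.tsum_eq]
  refine (Summable.tsum_prod hS₁).trans ?_
  refine Eq.trans ?_ (congrArg _ (Summable.tsum_prod hS₂).symm)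
  rw [← tsum_mul_left]
  refine tsum_congr fun y => ?_
  simp only [Function.comp_apply, summand_split hΩ.symm]
  rw [tsum_mul_left, hsum, mul_left_comm, mul_assoc κ]
  congr 1
  rw [← tsum_mul_left, ← tsum_mul_left]
  exact tsum_congr fun m => dual_summand hv ha (y, m)

/-- A nonzero theta constant forces multiplier 1. Squaring removes the undetermined sign of κ and
leaves exp(πiQ/10) = i, so Q = 5(1 + 4k). -/
theorem five_dvd_of_thetaConst_ne_zero {v : Fin 3 → ℂ} (hv : hermForm v < 0) {a : Fin 3 → ℤ}
    (ha : ∀ i, Odd (a i)) (h : thetaConst (charA a) (charB a) (periodMat v) ≠ 0) :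
    (5 : ℤ) ∣ 2 * a 0 ^ 2 + 2 * a 1 ^ 2 + a 2 ^ 2 := by
  obtain ⟨κ, hκ, heq⟩ := thetaConst_functional_equation hv ha
  have h1 : κ * Complex.exp (Real.pi * I * ((2 * a 0 ^ 2 + 2 * a 1 ^ 2 + a 2 ^ 2) / 20)) = 1 :=
    mul_right_cancel₀ h (by rw [← heq, one_mul])
  have h2 : Complex.exp (2 * (Real.pi * I * ((2 * a 0 ^ 2 + 2 * a 1 ^ 2 + a 2 ^ 2) / 20))) =
      Complex.exp (Real.pi / 2 * I) := by
    rw [Complex.exp_pi_div_two_mul_I, two_mul, Complex.exp_add]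
    have h3 := congrArg (· ^ 2) h1
    simp only [mul_pow, hκ, one_pow] at h3
    linear_combination I * h3 + Complex.exp (Real.pi * I * ((2 * a 0 ^ 2 + 2 * a 1 ^ 2 + a 2 ^ 2)
      / 20)) ^ 2 * Complex.I_sq
  obtain ⟨k, hk⟩ := Complex.exp_eq_exp_iff_exists_int.mp h2
  have hpi : (Real.pi : ℂ) * I ≠ 0 := mul_ne_zero (by exact_mod_cast Real.pi_ne_zero) Complex.I_ne_zero
  have h3 : ((2 * a 0 ^ 2 + 2 * a 1 ^ 2 + a 2 ^ 2 : ℤ) : ℂ) = ((5 * (1 + 4 * k) : ℤ) : ℂ) := by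
    push_cast
    apply mul_left_cancel₀ hpi
    linear_combination 10 * hk
  exact ⟨1 + 4 * k, Int.cast_injective h3⟩

/-! ### Passage to points of the projective plane -/

theorem mem_ball_mk {v : Fin 3 → ℂ} (hv : v ≠ 0) :
    Projectivization.mk ℂ v hv ∈ ball ↔ hermForm v < 0 := Iff.rfl

theorem periodMatrix_mk {v : Fin 3 → ℂ} (hv : v ≠ 0) :
    periodMatrix (Projectivization.mk ℂ v hv) = periodMat v := rfl

theorem summable_thetaTerm_periodMatrix {p : ℙ ℂ (Fin 3 → ℂ)} (hp : p ∈ ball) (a b : Fin 6 → ℝ) :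
    Summable (thetaTerm a b 0 (periodMatrix p)) := by
  induction p using Projectivization.ind with
  | h v hv =>
    rw [periodMatrix_mk]
    exact (isSiegel_periodMat ((mem_ball_mk hv).mp hp)).summable_thetaTerm a b

theorem vartheta_eq_ball {a : Fin 3 → ℤ} (ha : ∀ i, Odd (a i))
    (h : ¬ (5 : ℤ) ∣ 2 * a 0 ^ 2 + 2 * a 1 ^ 2 + a 2 ^ 2) : vartheta a = ball := by
  ext p
  refine ⟨fun hp => hp.1, fun hp => ⟨hp, ?_⟩⟩
  induction p using Projectivization.ind with
  | h v hv =>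
    rw [periodMatrix_mk]
    by_contra h0
    exact h (five_dvd_of_thetaConst_ne_zero ((mem_ball_mk hv).mp hp) ha h0)

/-! ### Residues modulo ten -/

/-- Exhaustive check of the 1000 residue triples modulo 10. -/
theorem remaining_spec : ∀ x ∈ Finset.Ico (0 : ℤ) 10, ∀ y ∈ Finset.Ico (0 : ℤ) 10,
    ∀ z ∈ Finset.Ico (0 : ℤ) 10, ![x, y, z] ∈ remaining ↔
      (x % 2 = 1 ∧ y % 2 = 1 ∧ z % 2 = 1) ∧ (2 * x ^ 2 + 2 * y ^ 2 + z ^ 2) % 5 = 0 := by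
  decide +kernel

theorem remaining_bounds : ∀ e ∈ remaining, ∀ i, 0 ≤ e i ∧ e i < 10 := by
  decide +kernel

theorem residue_mem_remaining_iff (a : Fin 3 → ℤ) : (fun i => a i % 10) ∈ remaining ↔
    (∀ i, Odd (a i)) ∧ (5 : ℤ) ∣ 2 * a 0 ^ 2 + 2 * a 1 ^ 2 + a 2 ^ 2 := by
  have hm : ∀ i, a i % 10 ∈ Finset.Ico (0 : ℤ) 10 := fun i => Finset.mem_Ico.mpr
    ⟨Int.emod_nonneg _ (by norm_num), Int.emod_lt_of_pos _ (by norm_num)⟩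
  have hv : (fun i => a i % 10) = ![a 0 % 10, a 1 % 10, a 2 % 10] := by
    ext i
    fin_cases i <;> rfl
  rw [hv, remaining_spec _ (hm 0) _ (hm 1) _ (hm 2)]
  refine and_congr ?_ ?_
  · have h2 : ∀ i, a i % 10 % 2 = 1 ↔ Odd (a i) := fun i => by
      rw [Int.odd_iff]
      omega
    rw [h2, h2, h2, Fin.forall_fin_succ, Fin.forall_fin_two]
    rfl
  · rw [Int.dvd_iff_emod_eq_zero]
    have h5 : ∀ i, a i % 10 ≡ a i [ZMOD 5] := fun i => by
      rw [Int.ModEq]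
      omega
    have := (((h5 0).pow 2).mul_left 2).add (((h5 1).pow 2).mul_left 2) |>.add ((h5 2).pow 2)
    rw [Int.ModEq] at this
    rw [this]

theorem modEq_remaining_iff {a e : Fin 3 → ℤ} (he : e ∈ remaining) :
    (∀ i, a i ≡ e i [ZMOD 10]) ↔ (fun i => a i % 10) = e := by
  rw [funext_iff]
  refine forall_congr' fun i => ?_
  have := remaining_bounds e he i
  rw [Int.ModEq, Int.emod_eq_of_lt this.1 this.2]

end PentagonalTheta

theorem mainTheorem12 :
    -- the vanishing statement (the theta series converging absolutely)
    (∀ a : Fin 3 → ℤ, PentagonalTheta.IsSigmaInvariant a →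
      ¬ (5 : ℤ) ∣ 2 * a 0 ^ 2 + 2 * a 1 ^ 2 + a 2 ^ 2 →
        PentagonalTheta.vartheta a = PentagonalTheta.ball ∧
        ∀ p ∈ PentagonalTheta.ball,
          Summable (PentagonalTheta.thetaTerm (PentagonalTheta.charA a) (PentagonalTheta.charB a)
            0 (PentagonalTheta.periodMatrix p))) ∧
    -- modulo 10, exactly 25 invariant characteristics satisfy the divisibility condition
    PentagonalTheta.remaining.card = 25 ∧
    (∀ a : Fin 3 → ℤ,
      (PentagonalTheta.IsSigmaInvariant a ∧ (5 : ℤ) ∣ 2 * a 0 ^ 2 + 2 * a 1 ^ 2 + a 2 ^ 2) ↔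
        ∃! e : Fin 3 → ℤ, e ∈ PentagonalTheta.remaining ∧ ∀ i, a i ≡ e i [ZMOD 10]) ∧
    -- hence every other invariant characteristic has an identically vanishing theta constant
    (∀ a : Fin 3 → ℤ, PentagonalTheta.IsSigmaInvariant a →
      (¬ ∃ e ∈ PentagonalTheta.remaining, ∀ i, a i ≡ e i [ZMOD 10]) →
        PentagonalTheta.vartheta a = PentagonalTheta.ball) := by
  refine ⟨fun a ha h => ⟨PentagonalTheta.vartheta_eq_ball
      ((PentagonalTheta.isSigmaInvariant_iff a).mp ha) h, fun p hp =>
      PentagonalTheta.summable_thetaTerm_periodMatrix hp _ _⟩, by decide +kernel, fun a => ?_,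
    fun a ha h => ?_⟩
  · rw [PentagonalTheta.isSigmaInvariant_iff, ← PentagonalTheta.residue_mem_remaining_iff]
    constructor
    · intro h
      refine ⟨_, ⟨h, (PentagonalTheta.modEq_remaining_iff h).mpr rfl⟩, fun e he => ?_⟩
      exact ((PentagonalTheta.modEq_remaining_iff he.1).mp he.2).symm
    · rintro ⟨e, ⟨he, hae⟩, -⟩
      rwa [(PentagonalTheta.modEq_remaining_iff he).mp hae]
  · have hodd := (PentagonalTheta.isSigmaInvariant_iff a).mp ha
    refine PentagonalTheta.vartheta_eq_ball hodd fun h5 => h ?_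
    have hmem := (PentagonalTheta.residue_mem_remaining_iff a).mpr ⟨hodd, h5⟩
    exact ⟨_, hmem, (PentagonalTheta.modEq_remaining_iff hmem).mpr rfl⟩
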